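/- Let $\mathbb F_q$ be a finite field, $A=\mathbb F_q[T]$, $K=\mathbb F_q(T)$, $K_\infty$ the completion of $K$ at $\infty=1/T$ with $|T|=q$, $\mathbb C_\infty$ the completion of an algebraic closure of $K_\infty$, and $\Omega=\mathbb C_\infty\setminus K_\infty$ the Drinfeld upper half-plane. For $f:\Omega\to\mathbb C_\infty$, $\gamma=\begin{pmatrix}a&b\\c&d\end{pmatrix}\in \mathrm{GL}_2(K_\infty)$ and $k,m\in\mathbb Z$ put $(f|_{k,m}\gamma)(z)=(\det\gamma)^m(cz+d)^{-k}f(\gamma z)$. Let $\Gamma\subset \mathrm{GL}_2(K)$ be an arithmetic subgroup of congruence type, i.e. $\Gamma$ is commensurable with $\mathrm{GL}_2(A)$ and contains $\Gamma(\mathfrak m)=\ker(\mathrm{GL}_2(A)\to \mathrm{GL}_2(A/\mathfrak m))$ for some nonzero ideal $\mathfrak m$ of $A$. Let $\mathcal O$ be the set of rigid analytic functions on $\Omega$ that are invariant under translation by some nonzero ideal of $A$. A rigid analytic function $f$ lies in $\widetilde M^{\leqslant\ell}_{k,m}(\Gamma)$ (Drinfeld quasi-modular forms of weight $k$, type $m$,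 depth at most $\ell$) if there are $f_0,\dots,f_\ell\in\mathcal O$ with $$(f|_{k,m}\gamma)(z)=\sum_{i=0}^{\ell}f_i(z)\Big(\frac{c}{cz+d}\Big)^i\qquad\text{for all }\gamma\in\Gamma,\ z\in\Omega,$$ such that for all $i$ and all $\gamma\in \mathrm{GL}_2(K)$ the function $f_i|_{k-2i,m-i}\gamma$ is bounded as $|z|_i:=\inf_{x\in K_\infty}|z-x|\to\infty$. The $f_i$ are uniquely determined by $f$, $k$ and $m$, and one puts, for $\gamma \in \mathrm{GL}_2(K_\infty)$, $$(f\|_{k,m}\gamma)(z)=\sum_{i=0}^{\ell}\Big(\frac{-c}{cz+d}\Big)^i(f_i|_{k-2i,m-i}\gamma)(z).$$ For $\eta\in \mathrm{GL}_2(K)$ the Hecke operator on $\widetilde M^{\leqslant\ell}_{k,m}(\Gamma)$ is $T_\eta f=(\det\eta)^{k-m}\sum_{\gamma}f\|_{k,m}\gamma$, where $\gamma$ runs over a (finite) set of representatives of $\Gamma\backslash\Gamma\eta\Gamma$. A $T_\eta$-eigenform of eigenvalue $\lambda$ is a nonzero quasi-modular form $f$ with $T_\eta f=\lambda f$. The hyperderivatives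 $\mathcal D_nf$ ($n\ge0$) of a rigid analytic function $f$ on $\Omega$ are defined by $f(z+\varepsilon)=\sum_{n\ge0}(\mathcal D_nf)(z)\,\varepsilon^n$ for $\varepsilon \in \mathbb C_\infty$ with $|\varepsilon|$ small. **Proposition.** Let $k,\ell\geqslant 0$ and $m$ be integers, $f\in\widetilde M^{\leqslant\ell}_{k,m}(\Gamma)$, $\eta\in \mathrm{GL}_2(K)$ and $n\geqslant 0$. Then $T_\eta f$ is rigid analytic, $\mathcal D_nf\in\widetilde M^{\leqslant\ell+n}_{k+2n,m+n}(\Gamma)$, and $$T_\eta(\mathcal D_nf)=(\det\eta)^n\,\mathcal D_n(T_\eta f).$$ In particular, if $f$ is a $T_\eta$-eigenform of eigenvalue $\lambda$ and $\mathcal D_nf\neq0$, then $\mathcal D_nf$ is a $T_\eta$-eigenform of eigenvalue $(\det\eta)^n\lambda$. -/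

import Mathlib

open scoped NNReal
open Polynomial

noncomputable section

namespace DrinfeldQM

/-! ### The fields `K = 𝔽_q(T)`, `K_∞` and `ℂ_∞`

Throughout, `F` is a finite field with `q` elements, `F[X]` is the ring `A = 𝔽_q[T]` and
`RatFunc F` is the field `K = 𝔽_q(T)`. -/

/-- The completion `K_∞` of `K` at the place `∞ = 1/T`. -/
abbrev KInf (F : Type*) [Field F] : Type _ :=
  @RatFunc.CompletionAtInfty F _ (Classical.decEq _)

lemma one_lt_card (F : Type*) [Field F] [Finite F] : (1 : ℝ≥0) < (Nat.card F : ℝ≥0) := by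
  exact_mod_cast Finite.one_lt_card

lemma val_X (F : Type*) [Field F] :
    Valued.v (algebraMap (RatFunc F) (KInf F) RatFunc.X) = WithZero.exp (1 : ℤ) := by
  classical
  rw [RatFunc.valuedCompletionAtInfty.def]
  let _ := @RatFunc.inftyValued F _ (Classical.decEq _)
  refine (Valued.extensionValuation_apply_coe (K := RatFunc F) RatFunc.X).trans ?_
  exact @RatFunc.inftyValuation.X F _ (Classical.decEq _)

/-- The value group of `K_∞` is embedded in the real numbers so that `|T| = q`. -/
instance instRankOneKInf (F : Type*) [Field F] [Finite F] :
    Valuation.RankOne (Valued.v : Valuation (KInf F) (WithZero (Multiplicative ℤ))) where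
  hom' := (WithZeroMulInt.toNNReal (one_lt_card F).ne_bot).comp
    MonoidWithZeroHom.ValueGroup₀.embedding
  strictMono' := (WithZeroMulInt.toNNReal_strictMono (one_lt_card F)).comp
    MonoidWithZeroHom.ValueGroup₀.embedding_strictMono
  exists_val_nontrivial := by
    refine ⟨algebraMap (RatFunc F) (KInf F) RatFunc.X, ?_, ?_⟩
    · rw [val_X]; exact WithZero.exp_ne_zero
    · rw [val_X]; exact (by decide : (WithZero.exp (1 : ℤ)) ≠ 1)

/-- The absolute value on `K_∞`, normalized by `|T| = q`. -/
instance instNormedKInf (F : Type*) [Field F] [Finite F] : NontriviallyNormedField (KInf F) :=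
  Valued.toNontriviallyNormedField (KInf F) (WithZero (Multiplicative ℤ))

instance instUltrametricKInf (F : Type*) [Field F] [Finite F] : IsUltrametricDist (KInf F) :=
  Valued.instIsUltrametricDist (KInf F) (WithZero (Multiplicative ℤ))

instance instCompleteKInf (F : Type*) [Field F] [Finite F] : CompleteSpace (KInf F) :=
  let _ := @RatFunc.inftyValued F _ (Classical.decEq _)
  inferInstanceAs (CompleteSpace (UniformSpace.Completion (RatFunc F)))

/-- An algebraic closure of `K_∞`. -/
abbrev KInfAlg (F : Type*) [Field F] : Type _ := AlgebraicClosure (KInf F)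

/-- The unique extension of the absolute value of `K_∞` to its algebraic closure. -/
instance instNormedKInfAlg (F : Type*) [Field F] [Finite F] :
    NontriviallyNormedField (KInfAlg F) :=
  spectralNorm.nontriviallyNormedField (KInf F) (KInfAlg F)

instance instNormedAlgebraKInfAlg (F : Type*) [Field F] [Finite F] :
    NormedAlgebra (KInf F) (KInfAlg F) :=
  spectralNorm.normedAlgebra (KInf F) (KInfAlg F)

/-- `ℂ_∞`, the completion of an algebraic closure of `K_∞`. -/
abbrev CInf (F : Type*) [Field F] [Finite F] : Type _ := UniformSpace.Completion (KInfAlg F)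

variable {F : Type*} [Field F] [Finite F]

/-! ### The Drinfeld upper half-plane -/

variable (F) in
/-- The Drinfeld upper half-plane `Ω = ℙ¹(ℂ_∞) - ℙ¹(K_∞) = ℂ_∞ - K_∞`. -/
abbrev Omega : Type _ := {z : CInf F // z ∉ Set.range (algebraMap (KInf F) (CInf F))}

/-- `|z|_i = inf {|z - x| : x ∈ K_∞}`. -/
def imagAbs (z : Omega F) : ℝ := ⨅ x : KInf F, ‖(z : CInf F) - algebraMap (KInf F) (CInf F) x‖

/-- The standard affinoid subsets `Ω_n = {z ∈ Ω : |z| ≤ q ^ n, |z|_i ≥ q ^ (-n)}`, which form an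
admissible covering of `Ω`. -/
def affinoid (F : Type*) [Field F] [Finite F] (n : ℕ) : Set (Omega F) :=
  {z | ‖(z : CInf F)‖ ≤ (Nat.card F : ℝ) ^ n ∧ ((Nat.card F : ℝ) ^ n)⁻¹ ≤ imagAbs z}

/-- Rigid analytic functions on `Ω`: on every `Ω_n`, the function is a uniform limit of rational
functions without poles in `Ω_n`. As `ℂ_∞` is algebraically closed, such a rational function is a
polynomial `P` divided by a finite product of factors `z - a` with `a ∉ Ω_n`. -/
def IsRigidAnalytic (f : Omega F → CInf F) : Prop :=
  ∀ n : ℕ, ∀ δ : ℝ, 0 < δ → ∃ (P : (CInf F)[X]) (s : Multiset (CInf F)),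
    (∀ z ∈ affinoid F n, (z : CInf F) ∉ s) ∧
    ∀ z ∈ affinoid F n,
      ‖f z - P.eval (z : CInf F) / (s.map fun a => (z : CInf F) - a).prod‖ < δ

/-- The set `𝒪` of rigid analytic functions on `Ω` that are `I`-periodic for some nonzero ideal
`I` of `A`. -/
def periodicRigid (F : Type*) [Field F] [Finite F] : Set (Omega F → CInf F) :=
  {f | IsRigidAnalytic f ∧ ∃ I : Ideal F[X], I ≠ ⊥ ∧ ∀ a ∈ I, ∀ z w : Omega F,
    (w : CInf F) = z + algebraMap (KInf F) (CInf F)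
      (algebraMap (RatFunc F) (KInf F) (algebraMap F[X] (RatFunc F) a)) → f w = f z}

/-! ### The action of `GL₂(K_∞)` -/

/-- The factor `c z + d`. -/
def denom (γ : GL (Fin 2) (KInf F)) (z : Omega F) : CInf F :=
  algebraMap (KInf F) (CInf F) (γ 1 0) * z + algebraMap (KInf F) (CInf F) (γ 1 1)

lemma linear_ne_zero {c d : KInf F} (h : c ≠ 0 ∨ d ≠ 0) (z : Omega F) :
    algebraMap (KInf F) (CInf F) c * z + algebraMap (KInf F) (CInf F) d ≠ 0 := by
  intro h0
  by_cases hc : c = 0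
  · subst hc
    simp only [map_zero, zero_mul, zero_add] at h0
    exact (h.resolve_left (by simp)) ((_root_.map_eq_zero _).1 h0)
  · refine z.2 ⟨-d / c, ?_⟩
    have hc' : algebraMap (KInf F) (CInf F) c ≠ 0 := (_root_.map_ne_zero _).2 hc
    rw [map_div₀, map_neg, div_eq_iff hc']
    linear_combination -h0

lemma det_ne_zero {F : Type*} [Field F] (γ : GL (Fin 2) (KInf F)) : γ 0 0 * γ 1 1 - γ 0 1 * γ 1 0 ≠ 0 := by
  have h := γ.det.ne_zero
  rwa [Matrix.GeneralLinearGroup.val_det_apply, Matrix.det_fin_two] at h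

lemma denom_ne_zero (γ : GL (Fin 2) (KInf F)) (z : Omega F) : denom γ z ≠ 0 := by
  refine linear_ne_zero ?_ z
  by_contra! h
  exact det_ne_zero γ (by rw [h.1, h.2]; ring)

/-- The fractional linear transformation `z ↦ (a z + b) / (c z + d)` of `Ω`. -/
def moebius (γ : GL (Fin 2) (KInf F)) (z : Omega F) : Omega F :=
  ⟨(algebraMap (KInf F) (CInf F) (γ 0 0) * z + algebraMap (KInf F) (CInf F) (γ 0 1)) /
      denom γ z, by
    rintro ⟨x, hx⟩
    rw [eq_div_iff (denom_ne_zero γ z), denom] at hx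
    refine linear_ne_zero (c := γ 0 0 - x * γ 1 0) (d := γ 0 1 - x * γ 1 1) ?_ z ?_
    · by_contra! h
      exact det_ne_zero γ (by linear_combination γ 1 1 * h.1 - γ 1 0 * h.2)
    · simp only [map_sub, map_mul]
      linear_combination -hx⟩

/-- `det γ`, as an element of `ℂ_∞`. -/
def detC (γ : GL (Fin 2) (KInf F)) : CInf F :=
  algebraMap (KInf F) (CInf F) (γ.det : KInf F)

/-- The slash operator `(f |_{k,m} γ)(z) = (det γ)^m (c z + d)^(-k) f(γ z)`. -/
def slash (k m : ℤ) (f : Omega F → CInf F) (γ : GL (Fin 2) (KInf F)) : Omega F → CInf F :=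
  fun z => detC γ ^ m * denom γ z ^ (-k) * f (moebius γ z)

/-- `c / (c z + d)`. -/
def kappa (γ : GL (Fin 2) (KInf F)) (z : Omega F) : CInf F :=
  algebraMap (KInf F) (CInf F) (γ 1 0) / denom γ z

/-- The inclusion `GL₂(K) ⊆ GL₂(K_∞)`. -/
def toInf (F : Type*) [Field F] [Finite F] : GL (Fin 2) (RatFunc F) →* GL (Fin 2) (KInf F) :=
  Matrix.GeneralLinearGroup.map (algebraMap (RatFunc F) (KInf F))

/-! ### Arithmetic subgroups of congruence type -/

/-- The subgroup `GL₂(A)` of `GL₂(K)`. -/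
def glA (F : Type*) [Field F] : Subgroup (GL (Fin 2) (RatFunc F)) :=
  (Matrix.GeneralLinearGroup.map (n := Fin 2) (algebraMap F[X] (RatFunc F))).range

/-- The principal congruence subgroup `Γ(𝔪)`, the matrices in `GL₂(A)` that are congruent to the
identity modulo `𝔪`, as a subgroup of `GL₂(K)`. -/
def principalCongruence (F : Type*) [Field F] (I : Ideal F[X]) :
    Subgroup (GL (Fin 2) (RatFunc F)) :=
  (Matrix.GeneralLinearGroup.map (n := Fin 2) (Ideal.Quotient.mk I)).ker.map
    (Matrix.GeneralLinearGroup.map (n := Fin 2) (algebraMap F[X] (RatFunc F)))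

/-- `Γ` is an arithmetic subgroup of congruence type: it is commensurable with `GL₂(A)` and
contains `Γ(𝔪)` for some nonzero ideal `𝔪`. -/
def IsArithmeticCongruence {F : Type*} [Field F] (Γ : Subgroup (GL (Fin 2) (RatFunc F))) : Prop :=
  Subgroup.Commensurable Γ (glA F) ∧
    ∃ I : Ideal F[X], I ≠ ⊥ ∧ principalCongruence F I ≤ Γ

/-! ### Quasi-modular forms -/

/-- `P = ∑ f_i X^i` is an associated polynomial of `f` for the weight `k` and the type `m`: the
coefficients lie in `𝒪` and `(f |_{k,m} γ)(z) = ∑ f_i(z) (c / (c z + d))^i` for all `γ ∈ Γ`. -/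
def IsAssocPoly (Γ : Subgroup (GL (Fin 2) (RatFunc F))) (k m : ℤ) (f : Omega F → CInf F)
    (P : (Omega F → CInf F)[X]) : Prop :=
  (∀ i, P.coeff i ∈ periodicRigid F) ∧
  ∀ γ ∈ Γ, ∀ z : Omega F, slash k m f (toInf F γ) z =
    ∑ i ∈ Finset.range (P.natDegree + 1), P.coeff i z * kappa (toInf F γ) z ^ i

/-- `g` is bounded on vertical lines: `|g(z)|` is bounded as `|z|_i → ∞`. -/
def BoundedOnVerticalLines (g : Omega F → CInf F) : Prop :=
  ∃ N B : ℝ, ∀ z : Omega F, N ≤ imagAbs z → ‖g z‖ ≤ B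

/-- `f` belongs to the space of Drinfeld quasi-modular forms of weight `k`, type `m` and depth at
most `ℓ` for `Γ`. -/
def IsQuasiModularForm (Γ : Subgroup (GL (Fin 2) (RatFunc F))) (k m : ℤ) (ℓ : ℕ)
    (f : Omega F → CInf F) : Prop :=
  IsRigidAnalytic f ∧ ∃ P : (Omega F → CInf F)[X], IsAssocPoly Γ k m f P ∧ P.natDegree ≤ ℓ ∧
    ∀ (i : ℕ) (γ : GL (Fin 2) (RatFunc F)),
      BoundedOnVerticalLines (slash (k - 2 * i) (m - i) (P.coeff i) (toInf F γ))

open Classical in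
/-- The associated polynomial `P_f` of `f` (it is unique if it exists). -/
def assocPoly (Γ : Subgroup (GL (Fin 2) (RatFunc F))) (k m : ℤ) (f : Omega F → CInf F) :
    (Omega F → CInf F)[X] :=
  if h : ∃ P, IsAssocPoly Γ k m f P then h.choose else 0

/-- The double-slash operator
`(f ||_{k,m} γ)(z) = ∑ (-c / (c z + d))^i (f_i |_{k-2i,m-i} γ)(z)`, where `P_f = ∑ f_i X^i` is the
associated polynomial of `f` with respect to `Γ`. -/
def doubleSlash (Γ : Subgroup (GL (Fin 2) (RatFunc F))) (k m : ℤ) (f : Omega F → CInf F)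
    (γ : GL (Fin 2) (KInf F)) : Omega F → CInf F :=
  fun z => ∑ i ∈ Finset.range ((assocPoly Γ k m f).natDegree + 1),
    (-kappa γ z) ^ i * slash (k - 2 * i) (m - i) ((assocPoly Γ k m f).coeff i) γ z

/-! ### Hecke operators and hyperderivatives -/

/-- `R` is a set of representatives for the orbit space `Γ \ ΓηΓ`. -/
def IsOrbitRepresentatives {G : Type*} [Group G] (Γ : Subgroup G) (η : G) (R : Set G) : Prop :=
  R ⊆ DoubleCoset.doubleCoset η (Γ : Set G) (Γ : Set G) ∧
    ∀ g ∈ DoubleCoset.doubleCoset η (Γ : Set G) (Γ : Set G),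
      ∃! r, r ∈ R ∧ ∃ δ ∈ Γ, g = δ * r

/-- The Hecke operator `T_η f = (det η)^(k-m) ∑_{γ ∈ R} f ||_{k,m} γ` on quasi-modular forms of
weight `k` and type `m` for `Γ`, where `R` is a (necessarily finite) set of representatives for
`Γ \ ΓηΓ`. -/
def heckeOp (Γ : Subgroup (GL (Fin 2) (RatFunc F))) (η : GL (Fin 2) (RatFunc F))
    (R : Set (GL (Fin 2) (RatFunc F))) (k m : ℤ) (f : Omega F → CInf F) : Omega F → CInf F :=
  detC (toInf F η) ^ (k - m) • ∑ᶠ γ ∈ R, doubleSlash Γ k m f (toInf F γ)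

/-- `f` is a `T_η`-eigenform of eigenvalue `lam`: a nonzero quasi-modular form of weight `k` and
type `m` (and some depth) for `Γ` with `T_η f = lam f`. -/
def IsEigenform (Γ : Subgroup (GL (Fin 2) (RatFunc F))) (η : GL (Fin 2) (RatFunc F))
    (R : Set (GL (Fin 2) (RatFunc F))) (k m : ℤ) (lam : CInf F) (f : Omega F → CInf F) : Prop :=
  (∃ ℓ : ℕ, IsQuasiModularForm Γ k m ℓ f) ∧ f ≠ 0 ∧ heckeOp Γ η R k m f = lam • f

/-- `f(z + ε) = ∑ a_n ε^n` for all small `ε`. -/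
def HasTaylorCoeffs (f : Omega F → CInf F) (z : Omega F) (a : ℕ → CInf F) : Prop :=
  ∃ r : ℝ, 0 < r ∧ ∀ w : Omega F, ‖(w : CInf F) - z‖ < r →
    HasSum (fun n => a n * ((w : CInf F) - z) ^ n) (f w)

open Classical in
/-- The hyperderivative `𝒟_n f`: `(𝒟_n f)(z)` is the coefficient of `ε^n` in the expansion of
`f(z + ε)` at `ε = 0`, which exists and is unique if `f` is rigid analytic. -/
def hyperDeriv (n : ℕ) (f : Omega F → CInf F) : Omega F → CInf F :=
  fun z => if h : ∃ a, HasTaylorCoeffs f z a then h.choose n else 0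

end DrinfeldQM

end

open DrinfeldQM

noncomputable section

namespace DrinfeldQM

section

/-! ### Power series on closed discs over a complete non-archimedean field -/

section PowerSeries

open Filter Topology Finset

variable {C : Type*} [NormedField C]

/-! Hyperderivatives are handled through Taylor expansions. If `f` is rigid analytic, `f(z + ε)` is
a power series on every closed disc of radius `|c| < |z|_i`. The non-archimedean Cauchy estimate
`HasPS.coeff_le` bounds its coefficients by the sup norm. It gives uniqueness of expansions, their
passage to uniform limits, rigid analyticity of `𝒟_n f`, and preservation of boundedness on vertical
lines.

The core is `slash_hyperDeriv`. Put `κ = c / (c z + d)` and `μ = det γ / (c z + d)²`. Then `γ(z + v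
/ (1 - κ v)) = γ z + μ v` exactly, so comparing the expansion of `f` at `γ z` with that of `f|γ` at
`z` gives `(𝒟_n f)|_{k+2n,m+n} γ = ∑_{r+s=n} binom(k+n-1, s) κ^s 𝒟_r(f|_{k,m} γ)`.

For `γ ∈ Γ`, insert `f|γ = ∑ f_i κ^i`. The Leibniz rule and Vandermonde's identity show that
`derivPoly`, with terms `binom(k+n-i-1, s) 𝒟_r f_i X^(i+s)`, is an associated polynomial of `𝒟_n f`.
Applying the formula to each `f_i` instead, for arbitrary `γ`, gives `(𝒟_n f)||γ = 𝒟_n(f||γ)`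
(`sum_slash_derivPoly`); the binomial input is `sum_choose_mul_choose_neg`.

Associated polynomials are unique (`IsAssocPoly.unique`), and `Γ \ ΓηΓ` is finite because `η`
commensurates `GL₂(A)`. Summing over representatives gives the theorem; the factor `(det η)^n` comes
only from the normalization `(det η)^(k-m)` of the Hecke operator. -/

/-- `g(ε) = ∑ a_n ε^n` on the closed disc of radius `|c|`. -/
def HasPS (c : C) (g : C → C) (a : ℕ → C) : Prop :=
  ∀ ε, ‖ε‖ ≤ ‖c‖ → HasSum (fun n => a n * ε ^ n) (g ε)

/-- There are roots of unity of arbitrarily large order prime to the residue characteristic. -/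
class ManyRoots (C : Type*) [NormedField C] : Prop where
  exists_root : ∀ N : ℕ, ∃ n ≥ N, ‖(n : C)‖ = 1 ∧ ∃ ζ : C, IsPrimitiveRoot ζ n

lemma hasSum_congr_fun {ι : Type*} {f f' : ι → C} {s : C} (h : ∀ i, f i = f' i) :
    HasSum f s ↔ HasSum f' s := by rw [funext h]

namespace HasPS

variable {c c' : C} {g g' : C → C} {a a' : ℕ → C}

lemma mono (h : HasPS c g a) (hc : ‖c'‖ ≤ ‖c‖) : HasPS c' g a :=
  fun ε hε => h ε (hε.trans hc)

lemma congr (h : HasPS c g a) (hg : ∀ ε, ‖ε‖ ≤ ‖c‖ → g ε = g' ε) : HasPS c g' a :=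
  fun ε hε => hg ε hε ▸ h ε hε

lemma add (h : HasPS c g a) (h' : HasPS c g' a') :
    HasPS c (fun ε => g ε + g' ε) (fun n => a n + a' n) := fun ε hε => by
  simpa only [add_mul] using (h ε hε).add (h' ε hε)

lemma sub (h : HasPS c g a) (h' : HasPS c g' a') :
    HasPS c (fun ε => g ε - g' ε) (fun n => a n - a' n) := fun ε hε => by
  simpa only [sub_mul] using (h ε hε).sub (h' ε hε)

lemma const_mul (h : HasPS c g a) (b : C) : HasPS c (fun ε => b * g ε) (fun n => b * a n) :=
  fun ε hε => by simpa only [mul_assoc] using (h ε hε).mul_left b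

lemma scale (h : HasPS c g a) {b : C} (hb : ‖b * c'‖ ≤ ‖c‖) :
    HasPS c' (fun ε => g (b * ε)) (fun n => a n * b ^ n) := fun ε hε => by
  have := h (b * ε) (le_trans (by rw [norm_mul, norm_mul]; gcongr) hb)
  simpa only [mul_pow, mul_assoc] using this

lemma of_polynomial (c z : C) (P : C[X]) :
    HasPS c (fun ε => P.eval (z + ε)) (fun n => (hasseDeriv n P).eval z) := fun ε _ => by
  have h : P.eval (z + ε) =
      ∑ n ∈ range ((taylor z P).natDegree + 1), (hasseDeriv n P).eval z * ε ^ n := by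
    rw [add_comm, ← taylor_eval, eval_eq_sum_range]
    simp only [taylor_coeff]
  change HasSum _ (P.eval (z + ε))
  rw [h]
  refine hasSum_sum_of_ne_finset_zero fun n hn => ?_
  change eval z (hasseDeriv n P) * ε ^ n = 0
  rw [← taylor_coeff,
    coeff_eq_zero_of_natDegree_lt 
    (Nat.lt_of_not_le fun hle => hn (mem_range.2 (Nat.lt_succ_of_le hle))),
    zero_mul]

lemma tendsto (h : HasPS c g a) : Tendsto (fun n => ‖a n‖ * ‖c‖ ^ n) atTop (𝓝 0) := by
  have := (h c le_rfl).summable.tendsto_atTop_zero.norm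
  simpa using this

variable [IsUltrametricDist C]

lemma _root_.DrinfeldQM.norm_hasSum_le {ι : Type*} {f : ι → C} {s : C} {B : ℝ} (hB : 0 ≤ B)
    (hf : HasSum f s) (h : ∀ i, ‖f i‖ ≤ B) : ‖s‖ ≤ B :=
  le_of_tendsto hf.norm (Eventually.of_forall fun _ =>
    IsUltrametricDist.norm_sum_le_of_forall_le_of_nonneg hB fun i _ => h i)

/-- The Cauchy estimate. -/
lemma coeff_le [ManyRoots C] (h : HasPS c g a) {B : ℝ} (hB : ∀ ε, ‖ε‖ ≤ ‖c‖ → ‖g ε‖ ≤ B) (n : ℕ) :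
    ‖a n‖ * ‖c‖ ^ n ≤ B := by
  have hB0 : 0 ≤ B := (norm_nonneg _).trans (hB c le_rfl)
  refine le_of_forall_pos_le_add fun δ hδ => ?_
  obtain ⟨M, hM⟩ := (h.tendsto.eventually (gt_mem_nhds hδ)).exists_forall_of_atTop
  -- Averaging over the points `c ζ^i` replaces the contour integral. The order `N` exceeds `n` and
  -- is so large that all terms from index `N` on are below `δ`, so no index congruent to `n` modulo
  -- `N` interferes.
  obtain ⟨N, hN, hN1, ζ, hζ⟩ := ManyRoots.exists_root (C := C) (max M (n + 1))
  have hMN : M ≤ N := (le_max_left _ _).trans hN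
  have hnN : n < N := (le_max_right _ _).trans hN
  have hζ1 : ‖ζ‖ = 1 := (pow_eq_one_iff_of_nonneg (norm_nonneg ζ) (n := N) (by omega)).1 (by
    rw [← norm_pow, hζ.pow_eq_one, norm_one])
  have hζ0 : ζ ≠ 0 := hζ.ne_zero (by omega)
  have key : ∀ i, ‖∑ j ∈ range N, a j * (c * ζ ^ i) ^ j‖ ≤ B + δ := fun i => by
    have hi : ‖c * ζ ^ i‖ ≤ ‖c‖ := by simp [hζ1]
    have hs := (hasSum_nat_add_iff' N).2 (h _ hi)
    have h1 := norm_hasSum_le hδ.le hs fun j => by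
      have := (hM (j + N) (by omega)).le
      simpa [hζ1] using this
    calc _ = ‖g (c * ζ ^ i) - (g (c * ζ ^ i) - ∑ j ∈ range N, a j * (c * ζ ^ i) ^ j)‖ := by
            rw [sub_sub_cancel]
      _ ≤ _ := (norm_sub_le _ _).trans (add_le_add (hB _ hi) h1)
  -- Orthogonality of the powers of `ζ` isolates the coefficient of index `n`. The factor `N` is
  -- harmless since `‖N‖ = 1`.
  have dft : (N : C) * (a n * c ^ n) =
      ∑ i ∈ range N, (ζ ^ n)⁻¹ ^ i * ∑ j ∈ range N, a j * (c * ζ ^ i) ^ j := by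
    simp_rw [mul_sum]
    rw [sum_comm, sum_eq_single_of_mem n (mem_range.2 hnN)]
    · have : ∀ i ∈ range N, (ζ ^ n)⁻¹ ^ i * (a n * (c * ζ ^ i) ^ n) = a n * c ^ n := fun i _ => by
        rw [mul_pow, ← pow_mul, mul_comm i n, pow_mul, inv_pow]
        field_simp
      rw [sum_congr rfl this]
      simp
    · intro j hj hjn
      have : ∀ i ∈ range N, (ζ ^ n)⁻¹ ^ i * (a j * (c * ζ ^ i) ^ j) =
          a j * c ^ j * (ζ ^ j * (ζ ^ n)⁻¹) ^ i := fun i _ => by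
        rw [mul_pow, mul_pow, ← pow_mul ζ i j, ← pow_mul ζ j i, mul_comm i j]
        ring
      rw [sum_congr rfl this, ← mul_sum]
      have h1 : ζ ^ j * (ζ ^ n)⁻¹ ≠ 1 := fun h1 => hjn <|
        hζ.pow_inj (mem_range.1 hj) hnN (by field_simp at h1; exact h1)
      have h2 : (ζ ^ j * (ζ ^ n)⁻¹) ^ N = 1 := by
        rw [mul_pow, inv_pow, ← pow_mul, ← pow_mul, mul_comm j, mul_comm n, pow_mul, pow_mul,
          hζ.pow_eq_one]
        simp
      rw [geom_sum_eq h1, h2]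
      simp
  calc ‖a n‖ * ‖c‖ ^ n = ‖(N : C) * (a n * c ^ n)‖ := by simp [hN1]
    _ ≤ B + δ := by
      rw [dft]
      refine IsUltrametricDist.norm_sum_le_of_forall_le_of_nonneg (by positivity) fun i _ => ?_
      simpa [hζ1] using key i

lemma unique [ManyRoots C] (hc : c ≠ 0) (h : HasPS c g a) (h' : HasPS c g a') : a = a' := by
  funext n
  have := (h.sub h').coeff_le (B := 0) (by simp) n
  have hc' : 0 < ‖c‖ ^ n := by positivity
  have h0 : ‖a n - a' n‖ ≤ 0 := by nlinarith
  exact sub_eq_zero.1 (norm_le_zero_iff.1 h0)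

variable [CompleteSpace C]

lemma summable_of_tendsto (h : Tendsto (fun n => ‖a n‖ * ‖c‖ ^ n) atTop (𝓝 0)) {ε : C}
    (hε : ‖ε‖ ≤ ‖c‖) : Summable fun n => a n * ε ^ n := by
  refine NonarchimedeanAddGroup.summable_of_tendsto_cofinite_zero ?_
  rw [Nat.cofinite_eq_atTop]
  refine squeeze_zero_norm (fun n => ?_) h
  rw [norm_mul, norm_pow]
  gcongr

/-- By the Cauchy estimate, uniformly close functions have coefficients close in the weight `‖c‖ ^
n`, uniformly in `n`. The coefficients of the approximants therefore converge, and the limit series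
inherits both the decay and the value. -/
lemma of_limit [ManyRoots C] (hc : c ≠ 0)
    (h : ∀ δ > 0, ∃ g' a', HasPS c g' a' ∧ ∀ ε, ‖ε‖ ≤ ‖c‖ → ‖g ε - g' ε‖ ≤ δ) :
    ∃ a, HasPS c g a := by
  have hc' : ∀ n, 0 < ‖c‖ ^ n := fun n => by positivity
  choose! G A hG hGA using h
  have hdiff : ∀ δ > 0, ∀ δ' > 0, ∀ n, ‖A δ n - A δ' n‖ * ‖c‖ ^ n ≤ δ + δ' := by
    intro δ hδ δ' hδ' n
    refine ((hG δ hδ).sub (hG δ' hδ')).coeff_le (fun ε hε => ?_) n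
    calc _ = ‖(g ε - G δ' ε) - (g ε - G δ ε)‖ := by congr 1; ring
      _ ≤ δ' + δ := (norm_sub_le _ _).trans (add_le_add (hGA δ' hδ' ε hε) (hGA δ hδ ε hε))
      _ = _ := add_comm _ _
  let u : ℕ → ℝ := fun k => 1 / ((k : ℝ) + 1)
  have hu : ∀ k, 0 < u k := fun k => by positivity
  have hu0 : Tendsto u atTop (𝓝 0) := tendsto_one_div_add_atTop_nhds_zero_nat
  have hcau : ∀ n, CauchySeq fun k => A (u k) n := by
    intro n
    refine Metric.cauchySeq_iff'.2 fun e he => ?_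
    have : ∀ᶠ k in atTop, u k < e * ‖c‖ ^ n / 2 :=
      hu0.eventually (gt_mem_nhds (by have := hc' n; positivity))
    obtain ⟨K, hK⟩ := this.exists_forall_of_atTop
    refine ⟨K, fun k hk => ?_⟩
    rw [dist_eq_norm]
    have h1 := hdiff _ (hu k) _ (hu K) n
    have h2 := hK k hk
    have h3 := hK K le_rfl
    exact lt_of_mul_lt_mul_right (by linarith) (hc' n).le
  choose b hb using fun n => cauchySeq_tendsto_of_complete (hcau n)
  have hbA : ∀ δ > 0, ∀ n, ‖b n - A δ n‖ * ‖c‖ ^ n ≤ δ := by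
    intro δ hδ n
    have h1 : Tendsto (fun k => ‖A (u k) n - A δ n‖ * ‖c‖ ^ n) atTop
        (𝓝 (‖b n - A δ n‖ * ‖c‖ ^ n)) := (((hb n).sub_const _).norm).mul_const _
    have h2 : Tendsto (fun k => u k + δ) atTop (𝓝 δ) := by simpa using hu0.add_const δ
    exact le_of_tendsto_of_tendsto' h1 h2 fun k => hdiff _ (hu k) δ hδ n
  have hb0 : Tendsto (fun n => ‖b n‖ * ‖c‖ ^ n) atTop (𝓝 0) := by
    refine Metric.tendsto_atTop.2 fun e he => ?_
    obtain ⟨M, hM⟩ := ((hG (e / 2) (half_pos he)).tendsto.eventually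
      (gt_mem_nhds (half_pos he))).exists_forall_of_atTop
    refine ⟨M, fun n hn => ?_⟩
    have h1 := hbA (e / 2) (half_pos he) n
    have h2 := hM n hn
    have h3 : ‖b n‖ ≤ ‖b n - A (e / 2) n‖ + ‖A (e / 2) n‖ := by
      simpa using norm_add_le (b n - A (e / 2) n) (A (e / 2) n)
    have h4 := mul_le_mul_of_nonneg_right h3 (hc' n).le
    rw [Real.dist_eq, sub_zero, abs_of_nonneg (by positivity)]
    linarith
  refine ⟨b, fun ε hε => ?_⟩
  have hs := (summable_of_tendsto hb0 hε).hasSum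
  suffices g ε = ∑' n, b n * ε ^ n by rwa [this]
  refine eq_of_forall_dist_le fun e he => ?_
  have h1 : ‖∑' n, b n * ε ^ n - G (e / 2) ε‖ ≤ e / 2 := by
    refine norm_hasSum_le (half_pos he).le (hs.sub (hG _ (half_pos he) ε hε)) fun n => ?_
    rw [← sub_mul, norm_mul, norm_pow]
    exact le_trans (by gcongr) (hbA _ (half_pos he) n)
  have h2 := hGA _ (half_pos he) ε hε
  rw [dist_eq_norm]
  calc _ = ‖(g ε - G (e / 2) ε) - (∑' n, b n * ε ^ n - G (e / 2) ε)‖ := by congr 1; ring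
    _ ≤ e / 2 + e / 2 := (norm_sub_le _ _).trans (add_le_add h2 h1)
    _ = e := add_halves e

instance _root_.DrinfeldQM.nonarchimedeanRing_of_isUltrametricDist : NonarchimedeanRing C where
  is_nonarchimedean := NonarchimedeanAddGroup.is_nonarchimedean

omit [CompleteSpace C] in
/-- A summable family on `ℕ × ℕ` may be summed along antidiagonals. -/
lemma _root_.DrinfeldQM.hasSum_antidiagonal {f : ℕ × ℕ → C} {s : C} (hf : HasSum f s) :
    HasSum (fun n => ∑ p ∈ antidiagonal n, f p) s := by
  have h2 := (HasAntidiagonal.sigmaAntidiagonalEquivProd (A := ℕ)).hasSum_iff.2 hf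
  have h3 := h2.sigma fun n => hasSum_fintype _
  refine (hasSum_congr_fun fun n => ?_).1 h3
  exact Finset.sum_coe_sort (antidiagonal n) f

omit [CompleteSpace C] in
lemma mul (h : HasPS c g a) (h' : HasPS c g' a') :
    HasPS c (fun ε => g ε * g' ε) (fun n => ∑ p ∈ antidiagonal n, a p.1 * a' p.2) := fun ε hε => by
  have h1 := (h ε hε).mul_of_nonarchimedean (h' ε hε)
  refine (hasSum_congr_fun fun n => ?_).1 (hasSum_antidiagonal h1)
  rw [sum_mul]
  refine Finset.sum_congr rfl fun p hp => ?_
  rw [← mem_antidiagonal.1 hp, pow_add]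
  ring

omit [CompleteSpace C] in
lemma inv_linear {b : C} (hb : ‖c‖ < ‖b‖) :
    HasPS c (fun ε => (b + ε)⁻¹) (fun n => (-1) ^ n * (b ^ (n + 1))⁻¹) := fun ε hε => by
  have hb0 : b ≠ 0 := fun h => by simp [h] at hb; exact absurd (norm_nonneg c) (not_le.2 hb)
  have h1 : ‖-ε / b‖ < 1 := by
    rw [norm_div, norm_neg, div_lt_one (norm_pos_iff.2 hb0)]
    exact hε.trans_lt hb
  have h2 := (hasSum_geometric_of_norm_lt_one h1).mul_left b⁻¹
  have h3 : b⁻¹ * (1 - -ε / b)⁻¹ = (b + ε)⁻¹ := by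
    rw [← mul_inv]; congr 1; field_simp; ring
  rw [h3] at h2
  refine (hasSum_congr_fun fun n => ?_).1 h2
  rw [div_pow, neg_pow]
  field_simp
  ring

omit [CompleteSpace C] in
lemma _root_.DrinfeldQM.norm_one_add {y : C} (hy : ‖y‖ < 1) : ‖1 + y‖ = 1 := by
  rw [IsUltrametricDist.norm_add_eq_max_of_norm_ne_norm] <;> simp [hy.le, hy.ne']

omit [CompleteSpace C] in
lemma _root_.DrinfeldQM.norm_intCast_le (n : ℤ) : ‖(n : C)‖ ≤ 1 :=
  IsUltrametricDist.norm_intCast_le_one C n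

/-- Integers have norm at most one, so the series converges. By Pascal's rule its sum is multiplied
by `1 + y` when `x` increases by one, so induction from `x = 0` in both directions determines it. -/
lemma _root_.DrinfeldQM.hasSum_one_add_zpow {y : C} (hy : ‖y‖ < 1) (x : ℤ) :
    HasSum (fun s => ((Ring.choose x s : ℤ) : C) * y ^ s) ((1 + y) ^ x) := by
  have hsum : ∀ x : ℤ, Summable fun s => ((Ring.choose x s : ℤ) : C) * y ^ s := fun x => by
    refine NonarchimedeanAddGroup.summable_of_tendsto_cofinite_zero ?_
    rw [Nat.cofinite_eq_atTop]
    refine squeeze_zero_norm (fun n => ?_) (tendsto_pow_atTop_nhds_zero_of_lt_one (norm_nonneg y) hy)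
    rw [norm_mul, norm_pow]
    exact mul_le_of_le_one_left (by positivity) (norm_intCast_le _)
  have hy0 : 1 + y ≠ 0 := fun h => by simpa [h] using norm_one_add hy
  have hstep : ∀ x : ℤ, ∑' s, ((Ring.choose (x + 1) s : ℤ) : C) * y ^ s =
      (1 + y) * ∑' s, ((Ring.choose x s : ℤ) : C) * y ^ s := fun x => by
    have h0 := (hsum x).hasSum
    have h1 := ((hasSum_nat_add_iff' 1).2 h0).add (h0.mul_left y)
    refine (hsum (x + 1)).hasSum.unique ?_
    have h2 : HasSum (fun s => ((Ring.choose (x + 1) (s + 1) : ℤ) : C) * y ^ (s + 1))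
        ((∑' s, ((Ring.choose x s : ℤ) : C) * y ^ s -
          ∑ s ∈ range 1, ((Ring.choose x s : ℤ) : C) * y ^ s) +
          y * ∑' s, ((Ring.choose x s : ℤ) : C) * y ^ s) := by
      refine (hasSum_congr_fun fun s => ?_).1 h1
      rw [Ring.choose_succ_succ, Int.cast_add, pow_succ]
      ring
    have h3 := (hasSum_nat_add_iff (f := fun s => ((Ring.choose (x + 1) s : ℤ) : C) * y ^ s) 1).1 h2
    refine (congrArg (HasSum _) ?_).mp h3
    simp only [sum_range_one, Ring.choose_zero_right, Int.cast_one, pow_zero]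
    ring
  have hval : ∀ x : ℤ, ∑' s, ((Ring.choose x s : ℤ) : C) * y ^ s = (1 + y) ^ x := by
    intro x
    induction x using Int.induction_on with
    | zero =>
      rw [tsum_eq_single 0]
      · simp
      · intro n hn
        simp [Ring.choose_zero_ite, hn]
    | succ n ih => rw [hstep, ih, zpow_add_one₀ hy0, mul_comm]
    | pred n ih =>
      have := hstep (-(n : ℤ) - 1)
      rw [sub_add_cancel, ih] at this
      rw [zpow_sub_one₀ hy0, this]
      field_simp
  exact hval x ▸ (hsum x).hasSum

lemma _root_.DrinfeldQM.hasSum_one_sub_zpow {y : C} (hy : ‖y‖ < 1) (x : ℤ) :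
    HasSum (fun s : ℕ => ((Ring.choose (x + s - 1) s : ℤ) : C) * y ^ s) ((1 - y) ^ (-x)) := by
  have := hasSum_one_add_zpow (y := -y) (by simpa using hy) (-x)
  rw [← sub_eq_add_neg] at this
  refine (hasSum_congr_fun fun s => ?_).1 this
  rw [Ring.choose_neg, neg_pow, Int.negOnePow_def, Units.smul_def]
  simp only [zpow_natCast, Units.val_pow_eq_pow_val, Units.val_neg, Units.val_one, smul_eq_mul,
    Int.cast_mul, Int.cast_pow, Int.cast_neg, Int.cast_one]
  have h1 : ((-1 : C) ^ s) * (-1) ^ s = 1 := by rw [← mul_pow]; simp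
  linear_combination ((Ring.choose (x + (s : ℕ) - 1) s : ℤ) : C) * y ^ s * h1

lemma zpow_linear {b : C} (hb : ‖b * c‖ < 1) (x : ℤ) :
    HasPS c (fun ε => (1 + b * ε) ^ x) (fun s => ((Ring.choose x s : ℤ) : C) * b ^ s) := fun ε hε => by
  have h1 : ‖b * ε‖ < 1 := by
    refine lt_of_le_of_lt ?_ hb
    rw [norm_mul, norm_mul]
    gcongr
  simpa only [mul_pow, mul_assoc] using hasSum_one_add_zpow h1 x

/-- Substitution of `v / (1 - b v)` in a power series, with an automorphy factor of weight `x`. -/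
lemma subst (h : HasPS c g a) {b : C} (hb : ‖b * c‖ < 1) (x : ℤ) :
    HasPS c (fun v => (1 - b * v) ^ (-x) * g (v / (1 - b * v)))
      (fun n => ∑ p ∈ antidiagonal n, ((Ring.choose (x + n - 1) p.2 : ℤ) : C) * b ^ p.2 * a p.1) := by
  intro v hv
  have h1 : ‖b * v‖ < 1 := by
    refine lt_of_le_of_lt ?_ hb
    rw [norm_mul, norm_mul]
    gcongr
  have h2 : ‖1 - b * v‖ = 1 := by
    rw [sub_eq_add_neg]; exact norm_one_add (by simpa using h1)
  have h20 : 1 - b * v ≠ 0 := fun h => by simp [h] at h2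
  have h3 : ‖v / (1 - b * v)‖ ≤ ‖c‖ := by rwa [norm_div, h2, div_one]
  -- Each power `(1 - b v)^(-(x+r))` is expanded by the binomial series. The double family is
  -- dominated by the product of the series of `g` at `v` and a geometric series, so it may be
  -- summed by rows or by antidiagonals.
  let f : ℕ × ℕ → C := fun p =>
    a p.1 * v ^ p.1 * (((Ring.choose (x + p.1 + p.2 - 1) p.2 : ℤ) : C) * (b * v) ^ p.2)
  have hf : Summable f := by
    have h4 := (h v hv).mul_of_nonarchimedean (hasSum_geometric_of_norm_lt_one h1)
    refine NonarchimedeanAddGroup.summable_of_tendsto_cofinite_zero ?_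
    refine squeeze_zero_norm (fun p => ?_) (tendsto_zero_iff_norm_tendsto_zero.1
      h4.summable.tendsto_cofinite_zero)
    have h5 : ‖((Ring.choose (x + p.1 + p.2 - 1) p.2 : ℤ) : C) * (b * v) ^ p.2‖ ≤ ‖(b * v) ^ p.2‖ := by
      rw [norm_mul]
      exact mul_le_of_le_one_left (norm_nonneg _) (norm_intCast_le _)
    rw [norm_mul, norm_mul (a p.1 * v ^ p.1) ((b * v) ^ p.2)]
    exact mul_le_mul_of_nonneg_left h5 (norm_nonneg _)
  have h5 : ∀ r, HasSum (fun s => f (r, s)) (a r * v ^ r * (1 - b * v) ^ (-(x + r))) := fun r =>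
    (hasSum_one_sub_zpow h1 (x + r)).mul_left _
  have h6 := hf.hasSum.prod_fiberwise h5
  have h7 : HasSum (fun r : ℕ => a r * v ^ r * (1 - b * v) ^ (-(x + r)))
      ((1 - b * v) ^ (-x) * g (v / (1 - b * v))) := by
    refine (hasSum_congr_fun fun r => ?_).1 ((h _ h3).mul_left ((1 - b * v) ^ (-x)))
    rw [neg_add, zpow_add₀ h20, zpow_neg _ (r : ℤ), zpow_natCast, div_pow]
    field_simp
  have h8 := hf.hasSum
  rw [h6.unique h7] at h8
  refine (hasSum_congr_fun fun n => ?_).1 (hasSum_antidiagonal h8)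
  rw [sum_mul]
  refine Finset.sum_congr rfl fun p hp => ?_
  rw [← mem_antidiagonal.1 hp, pow_add]
  simp only [f, mul_pow]
  push_cast
  rw [add_assoc x]
  ring

end HasPS
end PowerSeries

end

section

variable {F : Type*} [Field F] [Finite F]

/-! ### The field `ℂ_∞` -/

instance instUltrametricKInfAlg : IsUltrametricDist (KInfAlg F) :=
  IsUltrametricDist.isUltrametricDist_of_isNonarchimedean_norm
    (isNonarchimedean_spectralNorm (K := KInf F) (L := KInfAlg F))

instance instUltrametricCInf : IsUltrametricDist (CInf F) :=
  IsUltrametricDist.isUltrametricDist_of_forall_norm_add_le_max_norm fun x y => by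
    refine UniformSpace.Completion.induction_on₂ x y
      (isClosed_le (by fun_prop) (by fun_prop)) fun a b => ?_
    rw [← UniformSpace.Completion.coe_add]
    simp only [UniformSpace.Completion.norm_coe]
    exact IsUltrametricDist.norm_add_le_max a b

instance instManyRootsCInf : ManyRoots (CInf F) where
  exists_root N := by
    have hq := Finite.one_lt_card (α := F)
    obtain ⟨s, hs⟩ := pow_unbounded_of_one_lt (N + 1) hq
    have hs0 : s ≠ 0 := by rintro rfl; simp at hs
    let φ : F →+* KInf F := (algebraMap (RatFunc F) (KInf F)).comp (algebraMap F (RatFunc F))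
    have hcard : ((Nat.card F : ℕ) : KInf F) = 0 := by
      have := Fintype.ofFinite F
      rw [← map_natCast φ, Nat.card_eq_fintype_card, Nat.cast_card_eq_zero, map_zero]
    have hn : (((Nat.card F) ^ s - 1 : ℕ) : KInf F) = -1 := by
      rw [Nat.cast_sub (by omega), Nat.cast_pow, hcard, zero_pow hs0]; simp
    have hnA : (((Nat.card F) ^ s - 1 : ℕ) : KInfAlg F) = -1 := by
      rw [← map_natCast (algebraMap (KInf F) (KInfAlg F)), hn]; simp
    have hnC : (((Nat.card F) ^ s - 1 : ℕ) : CInf F) = -1 := by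
      rw [← map_natCast (algebraMap (KInf F) (CInf F)), hn]; simp
    refine ⟨(Nat.card F) ^ s - 1, by omega, by rw [hnC]; simp, ?_⟩
    have : NeZero (((Nat.card F) ^ s - 1 : ℕ) : KInfAlg F) := ⟨by rw [hnA]; simp⟩
    obtain ⟨ζ, hζ⟩ := HasEnoughRootsOfUnity.exists_primitiveRoot (KInfAlg F) ((Nat.card F) ^ s - 1)
    exact ⟨_, hζ.map_of_injective (algebraMap (KInfAlg F) (CInf F)).injective⟩

lemma norm_algebraMap_CInf (x : KInf F) : ‖algebraMap (KInf F) (CInf F) x‖ = ‖x‖ :=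
  norm_algebraMap' _ _

lemma exists_norm_lt_CInf {r : ℝ} (hr : 0 < r) : ∃ c : CInf F, c ≠ 0 ∧ ‖c‖ < r := by
  obtain ⟨x, hx, hxr⟩ := NormedField.exists_norm_lt (KInf F) hr
  refine ⟨algebraMap (KInf F) (CInf F) x, ?_, by rwa [norm_algebraMap_CInf]⟩
  rw [← norm_pos_iff, norm_algebraMap_CInf]
  exact hx

/-! ### The geometry of `Ω` -/

lemma bddBelow_imagAbs (z : Omega F) :
    BddBelow (Set.range fun x : KInf F => ‖(z : CInf F) - algebraMap (KInf F) (CInf F) x‖) :=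
  ⟨0, by rintro _ ⟨x, rfl⟩; exact norm_nonneg _⟩

lemma imagAbs_le (z : Omega F) (x : KInf F) :
    imagAbs z ≤ ‖(z : CInf F) - algebraMap (KInf F) (CInf F) x‖ :=
  ciInf_le (bddBelow_imagAbs z) x

lemma imagAbs_pos (z : Omega F) : 0 < imagAbs z := by
  have hcl : IsClosed (Set.range (algebraMap (KInf F) (CInf F))) :=
    (algebraMap_isometry (KInf F) (CInf F)).isClosedEmbedding.isClosed_range
  obtain ⟨ε, hε, h⟩ := Metric.isOpen_iff.1 hcl.isOpen_compl z z.2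
  refine hε.trans_le (le_ciInf fun x => ?_)
  by_contra! hx
  exact h (by rwa [Metric.mem_ball, dist_eq_norm, norm_sub_rev]) ⟨x, rfl⟩

lemma norm_linear_ge (c d : KInf F) (z : Omega F) :
    ‖c‖ * imagAbs z ≤ ‖algebraMap (KInf F) (CInf F) c * z + algebraMap (KInf F) (CInf F) d‖ := by
  by_cases hc : c = 0
  · simp [hc]
  have hc' : algebraMap (KInf F) (CInf F) c ≠ 0 := (_root_.map_ne_zero _).2 hc
  have : algebraMap (KInf F) (CInf F) c * z + algebraMap (KInf F) (CInf F) d =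
      algebraMap (KInf F) (CInf F) c * (z - algebraMap (KInf F) (CInf F) (-d / c)) := by
    rw [map_div₀, map_neg]; field_simp; ring
  rw [this, norm_mul, norm_algebraMap_CInf]
  exact mul_le_mul_of_nonneg_left (imagAbs_le z _) (norm_nonneg _)

/-- The strict ultrametric inequality: in the open disc of radius `|z|_i` about `z`, distances to
points of `K_∞` do not change. So this disc lies in `Ω` and `|·|_i` is constant on it. -/
lemma norm_sub_eq_of_norm_sub_lt {z : Omega F} {w : CInf F} (h : ‖w - z‖ < imagAbs z) (x : KInf F) :
    ‖w - algebraMap (KInf F) (CInf F) x‖ = ‖(z : CInf F) - algebraMap (KInf F) (CInf F) x‖ := by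
  have h1 := h.trans_le (imagAbs_le z x)
  rw [← sub_add_sub_cancel w (z : CInf F), IsUltrametricDist.norm_add_eq_max_of_norm_ne_norm h1.ne,
    max_eq_right h1.le]

lemma notMem_range_of_norm_sub_lt {z : Omega F} {w : CInf F} (h : ‖w - z‖ < imagAbs z) :
    w ∉ Set.range (algebraMap (KInf F) (CInf F)) := by
  rintro ⟨x, rfl⟩
  have h1 := norm_sub_eq_of_norm_sub_lt h x
  rw [sub_self, norm_zero] at h1
  exact absurd (imagAbs_le z x) (by rw [← h1]; exact not_le.2 (imagAbs_pos z))

lemma imagAbs_eq_of_norm_sub_lt {z w : Omega F} (h : ‖(w : CInf F) - z‖ < imagAbs z) :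
    imagAbs w = imagAbs z :=
  iInf_congr fun x => norm_sub_eq_of_norm_sub_lt h x

lemma mem_affinoid_of_norm_sub_le {N : ℕ} {z w : Omega F} (hz : z ∈ affinoid F N)
    (h : ‖(w : CInf F) - z‖ < imagAbs z) (h' : ‖(w : CInf F) - z‖ ≤ (Nat.card F : ℝ) ^ N) :
    w ∈ affinoid F N := by
  refine ⟨?_, (imagAbs_eq_of_norm_sub_lt h).symm ▸ hz.2⟩
  rw [← sub_add_cancel (w : CInf F) z]
  exact (IsUltrametricDist.norm_add_le_max _ _).trans (max_le h' hz.1)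

lemma one_lt_card_real (F : Type*) [Finite F] [Field F] : (1 : ℝ) < (Nat.card F : ℝ) := by
  exact_mod_cast Finite.one_lt_card

lemma exists_affinoid_of_bounds {B r : ℝ} (hr : 0 < r) :
    ∃ N : ℕ, B ≤ (Nat.card F : ℝ) ^ N ∧
      ∀ z : Omega F, ‖(z : CInf F)‖ ≤ B → r ≤ imagAbs z → z ∈ affinoid F N := by
  obtain ⟨N, hN⟩ := pow_unbounded_of_one_lt (max B r⁻¹) (one_lt_card_real F)
  refine ⟨N, ((le_max_left _ _).trans hN.le), fun z h1 h2 =>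
    ⟨h1.trans ((le_max_left _ _).trans hN.le), le_trans ?_ h2⟩⟩
  exact inv_le_of_inv_le₀ hr ((le_max_right _ _).trans hN.le)

lemma norm_denom_pos (γ : GL (Fin 2) (KInf F)) (z : Omega F) : 0 < ‖denom γ z‖ :=
  norm_pos_iff.2 (denom_ne_zero γ z)

lemma detC_eq (γ : GL (Fin 2) (KInf F)) : detC γ =
    algebraMap (KInf F) (CInf F) (γ 0 0 * γ 1 1 - γ 0 1 * γ 1 0) := by
  rw [detC, Matrix.GeneralLinearGroup.val_det_apply, Matrix.det_fin_two]

lemma detC_ne_zero (γ : GL (Fin 2) (KInf F)) : detC γ ≠ 0 := by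
  rw [detC_eq]; exact (_root_.map_ne_zero _).2 (det_ne_zero γ)

/-- Write `γ z - x = L / (c z + d)` with `L = e z + g`. Then `det γ = e (c z + d) - c L`, and both
terms are controlled by `norm_linear_ge`. The bound keeps images of discs inside `Ω` and images of
affinoids inside affinoids. -/
lemma imagAbs_moebius_ge (γ : GL (Fin 2) (KInf F)) (z : Omega F) :
    ‖detC γ‖ * imagAbs z / ‖denom γ z‖ ^ 2 ≤ imagAbs (moebius γ z) := by
  refine le_ciInf fun x => ?_
  have hj := norm_denom_pos γ z
  have hi := imagAbs_pos z
  set e := γ 0 0 - x * γ 1 0 with he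
  set g := γ 0 1 - x * γ 1 1 with hg
  set L := algebraMap (KInf F) (CInf F) e * z + algebraMap (KInf F) (CInf F) g with hL
  have h1 : (moebius γ z : CInf F) - algebraMap (KInf F) (CInf F) x = L / denom γ z := by
    have := denom_ne_zero γ z
    simp only [moebius, hL, he, hg]
    rw [eq_div_iff this, sub_mul, div_mul_cancel₀ _ this]
    simp only [denom, map_sub, map_mul]
    ring
  have h2 : detC γ = algebraMap (KInf F) (CInf F) e * denom γ z -
      algebraMap (KInf F) (CInf F) (γ 1 0) * L := by
    rw [detC_eq]
    simp only [hL, he, hg, denom, map_sub, map_mul]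
    ring
  have h3 : ‖e‖ * imagAbs z ≤ ‖L‖ := norm_linear_ge e g z
  have h4 : ‖γ 1 0‖ * imagAbs z ≤ ‖denom γ z‖ := norm_linear_ge _ _ z
  have h5 : ‖detC γ‖ * imagAbs z ≤ ‖L‖ * ‖denom γ z‖ := by
    rw [h2, sub_eq_add_neg]
    refine (mul_le_mul_of_nonneg_right (IsUltrametricDist.norm_add_le_max _ _) hi.le).trans ?_
    rw [norm_neg, norm_mul, norm_mul, norm_algebraMap_CInf, norm_algebraMap_CInf]
    rcases max_cases (‖e‖ * ‖denom γ z‖) (‖γ 1 0‖ * ‖L‖) with h | h <;> rw [h.1]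
    · nlinarith
    · nlinarith [norm_nonneg L]
  rw [h1, norm_div, div_le_div_iff₀ (by positivity) hj]
  nlinarith

/-! ### Taylor expansions -/

open Classical in
/-- The function `ε ↦ f(z + ε)`, extended by zero. -/
def translate (f : Omega F → CInf F) (z : Omega F) (ε : CInf F) : CInf F :=
  if h : (z : CInf F) + ε ∉ Set.range (algebraMap (KInf F) (CInf F)) then f ⟨z + ε, h⟩ else 0

lemma translate_sub (f : Omega F → CInf F) (z w : Omega F) : translate f z (w - z) = f w := by
  have h : (z : CInf F) + (w - z) = w := by ring
  have h' : (z : CInf F) + (w - z) ∉ Set.range (algebraMap (KInf F) (CInf F)) := by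
    rw [h]; exact w.2
  rw [translate, dif_pos h']
  exact congrArg f (Subtype.ext h)

lemma exists_eq_add {z : Omega F} {ε : CInf F} (h : ‖ε‖ < imagAbs z) :
    ∃ w : Omega F, (w : CInf F) = z + ε :=
  ⟨⟨z + ε, notMem_range_of_norm_sub_lt (z := z) (by simpa using h)⟩, rfl⟩

lemma translate_eq (f : Omega F → CInf F) {z w : Omega F} {ε : CInf F} (h : (w : CInf F) = z + ε) :
    translate f z ε = f w := by
  rw [← translate_sub f z w, h, add_sub_cancel_left]

lemma HasPS.hasTaylorCoeffs {f : Omega F → CInf F} {z : Omega F} {c : CInf F} {a : ℕ → CInf F}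
    (hc : c ≠ 0) (h : HasPS c (translate f z) a) : HasTaylorCoeffs f z a :=
  ⟨‖c‖, norm_pos_iff.2 hc, fun w hw => by
    simpa only [translate_sub] using h (w - z) hw.le⟩

lemma HasTaylorCoeffs.exists_hasPS {f : Omega F → CInf F} {z : Omega F} {a : ℕ → CInf F}
    (h : HasTaylorCoeffs f z a) : ∃ r : ℝ, 0 < r ∧ ∀ c : CInf F, ‖c‖ < r →
      HasPS c (translate f z) a := by
  obtain ⟨r, hr, h⟩ := h
  refine ⟨min r (imagAbs z), lt_min hr (imagAbs_pos z), fun c hc ε hε => ?_⟩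
  obtain ⟨w, hw⟩ := exists_eq_add ((hε.trans_lt hc).trans_le (min_le_right _ _))
  have h1 : (w : CInf F) - z = ε := by rw [hw]; ring
  rw [translate_eq f hw, ← h1]
  exact h w (by rw [h1]; exact (hε.trans_lt hc).trans_le (min_le_left _ _))

/-- Any two expansions agree on a common smaller disc, so the choice made in `hyperDeriv` is
immaterial. -/
lemma HasPS.hyperDeriv_eq {f : Omega F → CInf F} {z : Omega F} {c : CInf F} {a : ℕ → CInf F}
    (hc : c ≠ 0) (h : HasPS c (translate f z) a) (n : ℕ) : hyperDeriv n f z = a n := by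
  have hex : ∃ a, HasTaylorCoeffs f z a := ⟨a, h.hasTaylorCoeffs hc⟩
  rw [hyperDeriv, dif_pos hex]
  obtain ⟨r, hr, h'⟩ := hex.choose_spec.exists_hasPS
  obtain ⟨c', hc', hcr⟩ := exists_norm_lt_CInf (F := F) (lt_min hr (norm_pos_iff.2 hc))
  exact congrFun ((h' c' (hcr.trans_le (min_le_left _ _))).unique hc'
    (h.mono (hcr.le.trans (min_le_right _ _)))) n

end

section

variable {F : Type*} [Field F] [Finite F]

/-! ### Rational functions without poles on the affinoids `Ω_N` -/

/-- On `Ω_N`, the function `g` is a rational function without poles in `Ω_N`. -/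
def IsRegularRational (N : ℕ) (g : Omega F → CInf F) : Prop :=
  ∃ (P : (CInf F)[X]) (s : Multiset (CInf F)),
    (∀ z ∈ affinoid F N, (z : CInf F) ∉ s) ∧
    ∀ z ∈ affinoid F N, g z = P.eval (z : CInf F) / (s.map fun a => (z : CInf F) - a).prod

lemma isRigidAnalytic_iff {f : Omega F → CInf F} : IsRigidAnalytic f ↔
    ∀ (N : ℕ) (δ : ℝ), 0 < δ → ∃ g, IsRegularRational N g ∧ ∀ z ∈ affinoid F N, ‖f z - g z‖ < δ := by
  constructor
  · intro h N δ hδ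
    obtain ⟨P, s, hs, h⟩ := h N δ hδ
    exact ⟨_, ⟨P, s, hs, fun z _ => rfl⟩, h⟩
  · intro h N δ hδ
    obtain ⟨g, ⟨P, s, hs, hg⟩, h⟩ := h N δ hδ
    exact ⟨P, s, hs, fun z hz => hg z hz ▸ h z hz⟩

lemma multiset_prod_sub_ne_zero {s : Multiset (CInf F)} {z : CInf F} (h : z ∉ s) :
    (s.map fun a => z - a).prod ≠ 0 := by
  refine Multiset.prod_ne_zero fun h0 => ?_
  obtain ⟨a, ha, h1⟩ := Multiset.mem_map.1 h0
  exact h (sub_eq_zero.1 h1 ▸ ha)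

lemma card_inv_pow_le (F : Type*) [Field F] [Finite F] (N : ℕ) :
    ((Nat.card F : ℝ) ^ N)⁻¹ ≤ (Nat.card F : ℝ) ^ N := by
  have := one_le_pow₀ (one_lt_card_real F).le (n := N)
  exact (inv_le_one_of_one_le₀ this).trans this

lemma card_inv_pow_pos (F : Type*) [Field F] [Finite F] (N : ℕ) :
    0 < ((Nat.card F : ℝ) ^ N)⁻¹ := by
  have := one_lt_card_real F
  positivity

/-- The disc of radius `r` about `z` lies in `Ω_N`, so it contains no pole. This bounds `1 / (z -
a)` on `Ω_N` and makes its Taylor series converge. -/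
lemma lt_norm_sub_of_notMem_affinoid {N : ℕ} {a : CInf F} (ha : ∀ z ∈ affinoid F N, (z : CInf F) ≠ a)
    {z : Omega F} (hz : z ∈ affinoid F N) {r : ℝ} (hr : r < imagAbs z)
    (hr' : r ≤ (Nat.card F : ℝ) ^ N) : r < ‖(z : CInf F) - a‖ := by
  by_contra! h
  rw [norm_sub_rev] at h
  have h1 := notMem_range_of_norm_sub_lt (h.trans_lt hr)
  exact ha ⟨a, h1⟩ (mem_affinoid_of_norm_sub_le hz (h.trans_lt hr) (h.trans hr')) rfl

namespace IsRegularRational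

variable {N : ℕ} {g g' : Omega F → CInf F}

lemma congr (h : IsRegularRational N g) (hg : ∀ z ∈ affinoid F N, g' z = g z) :
    IsRegularRational N g' := by
  obtain ⟨P, s, hs, h⟩ := h
  exact ⟨P, s, hs, fun z hz => (hg z hz).trans (h z hz)⟩

lemma eval (N : ℕ) (P : (CInf F)[X]) : IsRegularRational N fun z : Omega F => P.eval (z : CInf F) :=
  ⟨P, 0, by simp, by simp⟩

lemma const (N : ℕ) (b : CInf F) : IsRegularRational N fun _ : Omega F => b :=
  (eval N (C b)).congr (by simp)

lemma mul (h : IsRegularRational N g) (h' : IsRegularRational N g') :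
    IsRegularRational N fun z => g z * g' z := by
  obtain ⟨P, s, hs, h⟩ := h
  obtain ⟨P', s', hs', h'⟩ := h'
  refine ⟨P * P', s + s', fun z hz h0 => ?_, fun z hz => ?_⟩
  · rcases Multiset.mem_add.1 h0 with h0 | h0
    exacts [hs z hz h0, hs' z hz h0]
  · dsimp only
    rw [h z hz, h' z hz, Multiset.map_add, Multiset.prod_add, eval_mul, div_mul_div_comm]

lemma add (h : IsRegularRational N g) (h' : IsRegularRational N g') :
    IsRegularRational N fun z => g z + g' z := by
  obtain ⟨P, s, hs, h⟩ := h
  obtain ⟨P', s', hs', h'⟩ := h'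
  have hev : ∀ (s : Multiset (CInf F)) (z : CInf F),
      ((s.map fun a => X - C a).prod).eval z = (s.map fun a => z - a).prod := fun s z => by
    rw [eval_multiset_prod, Multiset.map_map]
    simp
  refine ⟨P * (s'.map fun a => X - C a).prod + (s.map fun a => X - C a).prod * P', s + s',
    fun z hz h0 => ?_, fun z hz => ?_⟩
  · rcases Multiset.mem_add.1 h0 with h0 | h0
    exacts [hs z hz h0, hs' z hz h0]
  · dsimp only
    rw [h z hz, h' z hz, Multiset.map_add, Multiset.prod_add, eval_add, eval_mul, eval_mul, hev, hev,
      div_add_div _ _ (multiset_prod_sub_ne_zero (hs z hz)) (multiset_prod_sub_ne_zero (hs' z hz))]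

lemma sum {ι : Type*} (s : Finset ι) {g : ι → Omega F → CInf F}
    (h : ∀ i ∈ s, IsRegularRational N (g i)) : IsRegularRational N fun z => ∑ i ∈ s, g i z := by
  classical
  induction s using Finset.induction_on with
  | empty => simpa using const N 0
  | insert i s hi ih =>
    simp only [Finset.sum_insert hi]
    exact (h i (Finset.mem_insert_self _ _)).add (ih fun j hj => h j (Finset.mem_insert_of_mem hj))

lemma pow (h : IsRegularRational N g) (n : ℕ) : IsRegularRational N fun z => g z ^ n := by
  induction n with
  | zero => simpa using const N 1
  | succ n ih => simpa only [pow_succ] using ih.mul h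

lemma inv_sub {a : CInf F} (ha : ∀ z ∈ affinoid F N, (z : CInf F) ≠ a) :
    IsRegularRational N fun z : Omega F => ((z : CInf F) - a)⁻¹ :=
  ⟨1, {a}, fun z hz h => ha z hz (Multiset.mem_singleton.1 h), by simp⟩

lemma linear (N : ℕ) (a b : CInf F) : IsRegularRational N fun z : Omega F => a * z + b :=
  (eval N (C a * X + C b)).congr (by simp)

lemma inv_linear {a b : CInf F} (h : ∀ z ∈ affinoid F N, a * (z : CInf F) + b ≠ 0) :
    IsRegularRational N fun z : Omega F => (a * (z : CInf F) + b)⁻¹ := by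
  by_cases ha : a = 0
  · exact (const N b⁻¹).congr (by simp [ha])
  · have h1 : ∀ z : CInf F, a * z + b = a * (z - -b / a) := fun z => by field_simp; ring
    refine ((const N a⁻¹).mul (inv_sub (a := -b / a) fun z hz h0 => h z hz ?_)).congr
      fun z _ => ?_
    · rw [h1, h0]; simp
    · rw [h1, mul_inv]

/-- Induction over the number of poles. -/
lemma induction {p : (Omega F → CInf F) → Prop}
    (hp : ∀ g g', (∀ z ∈ affinoid F N, g' z = g z) → p g → p g')
    (h0 : ∀ P : (CInf F)[X], p fun z => P.eval (z : CInf F))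
    (h1 : ∀ g (a : CInf F), (∀ z ∈ affinoid F N, (z : CInf F) ≠ a) → p g →
      p fun z => g z * ((z : CInf F) - a)⁻¹) (h : IsRegularRational N g) : p g := by
  obtain ⟨P, s, hs, h⟩ := h
  refine hp _ _ h ?_
  clear h
  induction s using Multiset.induction_on with
  | empty => exact hp _ _ (by simp) (h0 P)
  | cons a s ih =>
    refine hp _ _ (fun z _ => ?_) (h1 _ a (fun z hz h => hs z hz (by simp [h]))
      (ih fun z hz h => hs z hz (Multiset.mem_cons_of_mem h)))
    rw [Multiset.map_cons, Multiset.prod_cons, mul_comm, ← div_div, div_eq_mul_inv]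

lemma bounded (h : IsRegularRational N g) : ∃ B : ℝ, ∀ z ∈ affinoid F N, ‖g z‖ ≤ B := by
  refine h.induction (p := fun g => ∃ B : ℝ, ∀ z ∈ affinoid F N, ‖g z‖ ≤ B)
    (fun g g' hg h => ?_) (fun P => ?_) fun g a ha h => ?_
  · obtain ⟨B, hB⟩ := h
    exact ⟨B, fun z hz => hg z hz ▸ hB z hz⟩
  · refine ⟨∑ i ∈ Finset.range (P.natDegree + 1), ‖P.coeff i‖ * ((Nat.card F : ℝ) ^ N) ^ i,
      fun z hz => ?_⟩
    dsimp only
    rw [eval_eq_sum_range]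
    refine (norm_sum_le _ _).trans (Finset.sum_le_sum fun i _ => ?_)
    rw [norm_mul, norm_pow]
    gcongr
    exact hz.1
  · obtain ⟨B, hB⟩ := h
    have hr := card_inv_pow_pos F N
    refine ⟨B * (((Nat.card F : ℝ) ^ N)⁻¹ / 2)⁻¹, fun z hz => ?_⟩
    have h1 := lt_norm_sub_of_notMem_affinoid ha hz (r := ((Nat.card F : ℝ) ^ N)⁻¹ / 2)
      ((half_lt_self hr).trans_le hz.2) ((half_le_self hr.le).trans (card_inv_pow_le F N))
    rw [norm_mul, norm_inv]
    exact mul_le_mul (hB z hz) (inv_anti₀ (half_pos hr) h1.le) (by positivity)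
      ((norm_nonneg _).trans (hB z hz))

/-- Induction on the poles: Hasse derivatives for polynomials, then Cauchy products with the
geometric series of `1 / (z - a)`. It matters that each coefficient is again a regular rational
function of `z`, since these approximate the hyperderivatives of a rigid analytic function. -/
lemma exists_taylor (h : IsRegularRational N g) : ∃ G : ℕ → Omega F → CInf F,
    (∀ n, IsRegularRational N (G n)) ∧ ∀ z ∈ affinoid F N, ∀ c : CInf F, ‖c‖ < imagAbs z →
      ‖c‖ ≤ (Nat.card F : ℝ) ^ N → HasPS c (translate g z) fun n => G n z := by
  refine h.induction (p := fun g => ∃ G : ℕ → Omega F → CInf F,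
    (∀ n, IsRegularRational N (G n)) ∧ ∀ z ∈ affinoid F N, ∀ c : CInf F, ‖c‖ < imagAbs z →
      ‖c‖ ≤ (Nat.card F : ℝ) ^ N → HasPS c (translate g z) fun n => G n z)
    (fun g g' hg h => ?_) (fun P => ?_) fun g a ha h => ?_
  · obtain ⟨G, hG, h⟩ := h
    refine ⟨G, hG, fun z hz c hc hc' => (h z hz c hc hc').congr fun ε hε => ?_⟩
    obtain ⟨w, hw⟩ := exists_eq_add (hε.trans_lt hc)
    have hwz : (w : CInf F) - z = ε := by rw [hw]; ring
    rw [translate_eq g hw, translate_eq g' hw, hg]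
    exact mem_affinoid_of_norm_sub_le hz (by rw [hwz]; exact hε.trans_lt hc)
      (by rw [hwz]; exact hε.trans hc')
  · refine ⟨fun n z => (hasseDeriv n P).eval (z : CInf F), fun n => eval N _,
      fun z hz c hc _ => (HasPS.of_polynomial c z P).congr fun ε hε => ?_⟩
    obtain ⟨w, hw⟩ := exists_eq_add (hε.trans_lt hc)
    rw [translate_eq _ hw, hw]
  · obtain ⟨G, hG, h⟩ := h
    refine ⟨fun n z => ∑ p ∈ Finset.HasAntidiagonal.antidiagonal n,
      G p.1 z * ((-1) ^ p.2 * (((z : CInf F) - a) ^ (p.2 + 1))⁻¹), fun n => sum _ fun p _ => ?_,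
      fun z hz c hc hc' => ?_⟩
    · refine (hG p.1).mul ((const N _).mul (((inv_sub ha).pow (p.2 + 1)).congr fun z _ => ?_))
      rw [inv_pow]
    · refine ((h z hz c hc hc').mul (HasPS.inv_linear
        (lt_norm_sub_of_notMem_affinoid ha hz hc hc'))).congr fun ε hε => ?_
      obtain ⟨w, hw⟩ := exists_eq_add (hε.trans_lt hc)
      rw [translate_eq g hw, translate_eq _ hw, hw]
      congr 2
      ring

end IsRegularRational

/-! ### Rigid analytic functions -/

namespace IsRigidAnalytic

variable {f f' : Omega F → CInf F}

lemma of_regular (h : ∀ N, IsRegularRational N f) : IsRigidAnalytic f :=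
  isRigidAnalytic_iff.2 fun N δ hδ => ⟨f, h N, fun z _ => by rwa [sub_self, norm_zero]⟩

lemma bounded (h : IsRigidAnalytic f) (N : ℕ) : ∃ B : ℝ, ∀ z ∈ affinoid F N, ‖f z‖ ≤ B := by
  obtain ⟨g, hg, h⟩ := isRigidAnalytic_iff.1 h N 1 one_pos
  obtain ⟨B, hB⟩ := hg.bounded
  refine ⟨1 + B, fun z hz => ?_⟩
  calc ‖f z‖ = ‖(f z - g z) + g z‖ := by rw [sub_add_cancel]
    _ ≤ _ := (norm_add_le _ _).trans (add_le_add (h z hz).le (hB z hz))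

lemma const (b : CInf F) : IsRigidAnalytic fun _ : Omega F => b :=
  of_regular fun N => .const N b

lemma add (h : IsRigidAnalytic f) (h' : IsRigidAnalytic f') :
    IsRigidAnalytic fun z => f z + f' z := by
  rw [isRigidAnalytic_iff] at *
  intro N δ hδ
  obtain ⟨g, hg, h⟩ := h N _ (half_pos hδ)
  obtain ⟨g', hg', h'⟩ := h' N _ (half_pos hδ)
  refine ⟨_, hg.add hg', fun z hz => ?_⟩
  calc _ = ‖(f z - g z) + (f' z - g' z)‖ := by congr 1; ring
    _ < δ / 2 + δ / 2 := (norm_add_le _ _).trans_lt (add_lt_add (h z hz) (h' z hz))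
    _ = δ := add_halves δ

lemma mul (h : IsRigidAnalytic f) (h' : IsRigidAnalytic f') :
    IsRigidAnalytic fun z => f z * f' z := by
  rw [isRigidAnalytic_iff]
  intro N δ hδ
  obtain ⟨B, hB⟩ := h.bounded N
  obtain ⟨B', hB'⟩ := h'.bounded N
  set M := max (max B B') 0
  have hM0 : 0 ≤ M := le_max_right _ _
  have hM : ∀ z ∈ affinoid F N, ‖f z‖ ≤ M :=
    fun z hz => (hB z hz).trans ((le_max_left _ _).trans (le_max_left _ _))
  have hM' : ∀ z ∈ affinoid F N, ‖f' z‖ ≤ M :=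
    fun z hz => (hB' z hz).trans ((le_max_right _ _).trans (le_max_left _ _))
  set e := min 1 (δ / (2 * (M + 1))) with he
  have he0 : 0 < e := by positivity
  obtain ⟨g, hg, h⟩ := isRigidAnalytic_iff.1 h N e he0
  obtain ⟨g', hg', h'⟩ := isRigidAnalytic_iff.1 h' N e he0
  refine ⟨_, hg.mul hg', fun z hz => ?_⟩
  have h1 : ‖g' z‖ ≤ M + 1 := by
    calc ‖g' z‖ = ‖f' z - (f' z - g' z)‖ := by rw [sub_sub_cancel]
      _ ≤ M + 1 := (norm_sub_le _ _).trans (add_le_add (hM' z hz)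
        ((h' z hz).le.trans (min_le_left _ _)))
  have h2 : e * (2 * (M + 1)) ≤ δ := by
    rw [← le_div_iff₀ (by positivity)]; exact min_le_right _ _
  calc _ = ‖f z * (f' z - g' z) + (f z - g z) * g' z‖ := by congr 1; ring
    _ ≤ ‖f z‖ * ‖f' z - g' z‖ + ‖f z - g z‖ * ‖g' z‖ := by
      rw [← norm_mul, ← norm_mul]; exact norm_add_le _ _
    _ ≤ M * e + e * (M + 1) := by
      gcongr
      exacts [hM z hz, (h' z hz).le, (h z hz).le]
    _ < δ := by nlinarith

lemma sum {ι : Type*} (s : Finset ι) {f : ι → Omega F → CInf F}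
    (h : ∀ i ∈ s, IsRigidAnalytic (f i)) : IsRigidAnalytic fun z => ∑ i ∈ s, f i z := by
  classical
  induction s using Finset.induction_on with
  | empty => simpa using const 0
  | insert i s hi ih =>
    simp only [Finset.sum_insert hi]
    exact (h i (Finset.mem_insert_self _ _)).add (ih fun j hj => h j (Finset.mem_insert_of_mem hj))

lemma pow (h : IsRigidAnalytic f) (n : ℕ) : IsRigidAnalytic fun z => f z ^ n := by
  induction n with
  | zero => simpa using const 1
  | succ n ih => simpa only [pow_succ] using ih.mul h

lemma inv_denom (γ : GL (Fin 2) (KInf F)) : IsRigidAnalytic fun z => (denom γ z)⁻¹ :=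
  of_regular fun _ => .inv_linear fun z _ => denom_ne_zero γ z

lemma denom (γ : GL (Fin 2) (KInf F)) : IsRigidAnalytic (denom γ) :=
  of_regular fun N => .linear N _ _

lemma denom_zpow (γ : GL (Fin 2) (KInf F)) (n : ℤ) :
    IsRigidAnalytic fun z => DrinfeldQM.denom γ z ^ n := by
  obtain ⟨n, rfl | rfl⟩ := n.eq_nat_or_neg
  · simpa only [zpow_natCast] using (denom γ).pow n
  · simpa only [zpow_neg, zpow_natCast, inv_pow] using (inv_denom γ).pow n

lemma kappa (γ : GL (Fin 2) (KInf F)) : IsRigidAnalytic (kappa γ) := by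
  have h := (const (algebraMap (KInf F) (CInf F) (γ 1 0))).mul (inv_denom γ)
  simp only [← div_eq_mul_inv] at h
  exact h

end IsRigidAnalytic

lemma moebius_val (γ : GL (Fin 2) (KInf F)) (z : Omega F) : (moebius γ z : CInf F) =
    (algebraMap (KInf F) (CInf F) (γ 0 0) * z + algebraMap (KInf F) (CInf F) (γ 0 1)) /
      denom γ z := rfl

lemma exists_moebius_mem_affinoid (γ : GL (Fin 2) (KInf F)) (N : ℕ) :
    ∃ M : ℕ, ∀ z ∈ affinoid F N, moebius γ z ∈ affinoid F M := by
  obtain ⟨B, hB⟩ := (IsRegularRational.linear N (algebraMap (KInf F) (CInf F) (γ 0 0))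
    (algebraMap (KInf F) (CInf F) (γ 0 1))).mul
      (IsRegularRational.inv_linear fun z _ => denom_ne_zero γ z) |>.bounded
  obtain ⟨D, hD⟩ := (IsRigidAnalytic.denom γ).bounded N
  have hd : 0 < ‖detC γ‖ := norm_pos_iff.2 (detC_ne_zero γ)
  have hr := card_inv_pow_pos F N
  set D' := max D 1
  have hD' : 0 < D' := by positivity
  obtain ⟨M, -, hM⟩ := exists_affinoid_of_bounds (F := F) (B := B)
    (r := ‖detC γ‖ * ((Nat.card F : ℝ) ^ N)⁻¹ / D' ^ 2) (by positivity)
  refine ⟨M, fun z hz => hM _ ?_ ((imagAbs_moebius_ge γ z).trans' ?_)⟩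
  · rw [moebius_val, div_eq_mul_inv]
    exact hB z hz
  · have h1 := norm_denom_pos γ z
    have h2 : ‖denom γ z‖ ≤ D' := (hD z hz).trans (le_max_left _ _)
    have h3 := hz.2
    have h4 := (imagAbs_pos z).le
    gcongr

lemma IsRegularRational.comp_moebius {M N : ℕ} {g : Omega F → CInf F} {γ : GL (Fin 2) (KInf F)}
    (hγ : ∀ z ∈ affinoid F N, moebius γ z ∈ affinoid F M) (h : IsRegularRational M g) :
    IsRegularRational N fun z => g (moebius γ z) := by
  have hm : IsRegularRational N fun z : Omega F => (moebius γ z : CInf F) :=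
    ((linear N _ _).mul (inv_linear fun z _ => denom_ne_zero γ z)).congr
      fun z _ => by rw [moebius_val, div_eq_mul_inv]; rfl
  refine h.induction (p := fun g => IsRegularRational N fun z => g (moebius γ z))
    (fun g g' hg h => ?_) (fun P => ?_) fun g a ha h => ?_
  · exact h.congr fun z hz => hg _ (hγ z hz)
  · simp only [eval_eq_sum_range]
    exact sum _ fun i _ => (const N _).mul (hm.pow i)
  · refine h.mul ?_
    -- The pulled-back factor is a quotient of linear forms. The new numerator has coefficients in
    -- `ℂ_∞` and may vanish on `Ω`, but not on `Ω_N`, because `γ` maps `Ω_N` into `Ω_M`, where `a`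
    -- is not attained.
    have key : ∀ z : Omega F, (moebius γ z : CInf F) - a =
        ((algebraMap (KInf F) (CInf F) (γ 0 0) - a * algebraMap (KInf F) (CInf F) (γ 1 0)) * z +
        (algebraMap (KInf F) (CInf F) (γ 0 1) - a * algebraMap (KInf F) (CInf F) (γ 1 1))) /
        denom γ z := fun z => by
      have := denom_ne_zero γ z
      rw [eq_div_iff this, moebius_val, sub_mul, div_mul_cancel₀ _ this, denom]
      ring
    have hinv := inv_linear (N := N) (F := F)
      (a := algebraMap (KInf F) (CInf F) (γ 0 0) - a * algebraMap (KInf F) (CInf F) (γ 1 0))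
      (b := algebraMap (KInf F) (CInf F) (γ 0 1) - a * algebraMap (KInf F) (CInf F) (γ 1 1))
      fun z hz h0 => sub_ne_zero.2 (ha _ (hγ z hz)) (by rw [key, h0, zero_div])
    refine ((linear N (algebraMap (KInf F) (CInf F) (γ 1 0))
      (algebraMap (KInf F) (CInf F) (γ 1 1))).mul hinv).congr fun z hz => ?_
    rw [key, inv_div, div_eq_mul_inv]
    rfl

namespace IsRigidAnalytic

variable {f f' : Omega F → CInf F}

lemma comp_moebius (h : IsRigidAnalytic f) (γ : GL (Fin 2) (KInf F)) :
    IsRigidAnalytic fun z => f (moebius γ z) := by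
  rw [isRigidAnalytic_iff]
  intro N δ hδ
  obtain ⟨M, hM⟩ := exists_moebius_mem_affinoid γ N
  obtain ⟨g, hg, h⟩ := isRigidAnalytic_iff.1 h M δ hδ
  exact ⟨_, hg.comp_moebius hM, fun z hz => h _ (hM z hz)⟩

lemma slash (h : IsRigidAnalytic f) (k m : ℤ) (γ : GL (Fin 2) (KInf F)) :
    IsRigidAnalytic (slash k m f γ) :=
  ((const _).mul (denom_zpow γ _)).mul (h.comp_moebius γ)

/-- The Taylor expansion of a rigid analytic function converges on every disc contained in `Ω`. -/
lemma hasPS (h : IsRigidAnalytic f) (z : Omega F) {c : CInf F} (hc : c ≠ 0) (hcz : ‖c‖ < imagAbs z) :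
    HasPS c (translate f z) fun n => hyperDeriv n f z := by
  suffices ∃ a, HasPS c (translate f z) a by
    obtain ⟨a, ha⟩ := this
    simpa only [ha.hyperDeriv_eq hc] using ha
  obtain ⟨N, hN, hN'⟩ := exists_affinoid_of_bounds (F := F) (B := max ‖(z : CInf F)‖ ‖c‖)
    (imagAbs_pos z)
  have hz : z ∈ affinoid F N := hN' z (le_max_left _ _) le_rfl
  have hcN : ‖c‖ ≤ (Nat.card F : ℝ) ^ N := (le_max_right _ _).trans hN
  refine HasPS.of_limit hc fun δ hδ => ?_
  obtain ⟨g, hg, h⟩ := isRigidAnalytic_iff.1 h N δ hδ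
  obtain ⟨G, -, hG⟩ := hg.exists_taylor
  refine ⟨_, _, hG z hz c hcz hcN, fun ε hε => ?_⟩
  obtain ⟨w, hw⟩ := exists_eq_add (hε.trans_lt hcz)
  have hwz : (w : CInf F) - z = ε := by rw [hw]; ring
  rw [translate_eq g hw, translate_eq f hw]
  exact (h w (mem_affinoid_of_norm_sub_le hz (by rw [hwz]; exact hε.trans_lt hcz)
    (by rw [hwz]; exact hε.trans hcN))).le

/-- One radius `‖c‖ < q^(-N)` serves all points of `Ω_N`. The Cauchy estimate there turns an error
`δ ‖c‖^n / 2` for the function into an error below `δ` for its `n`-th hyperderivative. -/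
lemma hyperDeriv (h : IsRigidAnalytic f) (n : ℕ) : IsRigidAnalytic (hyperDeriv n f) := by
  rw [isRigidAnalytic_iff]
  intro N δ hδ
  obtain ⟨c, hc, hcN⟩ := exists_norm_lt_CInf (F := F) (card_inv_pow_pos F N)
  have hc0 : 0 < ‖c‖ ^ n := by have := norm_pos_iff.2 hc; positivity
  have hcN' := hcN.le.trans (card_inv_pow_le F N)
  obtain ⟨g, hg, h'⟩ := isRigidAnalytic_iff.1 h N (δ * ‖c‖ ^ n / 2) (by positivity)
  obtain ⟨G, hGr, hG⟩ := hg.exists_taylor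
  refine ⟨G n, hGr n, fun z hz => ?_⟩
  have hcz := hcN.trans_le hz.2
  have h1 := ((h.hasPS z hc hcz).sub (hG z hz c hcz hcN')).coeff_le
    (B := δ * ‖c‖ ^ n / 2) (fun ε hε => by
      obtain ⟨w, hw⟩ := exists_eq_add (hε.trans_lt hcz)
      have hwz : (w : CInf F) - z = ε := by rw [hw]; ring
      rw [translate_eq g hw, translate_eq f hw]
      exact (h' w (mem_affinoid_of_norm_sub_le hz (by rw [hwz]; exact hε.trans_lt hcz)
        (by rw [hwz]; exact hε.trans hcN'))).le) n
  exact lt_of_mul_lt_mul_right (h1.trans_lt (by linarith [mul_pos hδ hc0])) hc0.le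

end IsRigidAnalytic

end

section

/-! ### Binomial identities -/

lemma choose_neg_eq (x : ℤ) (n : ℕ) :
    Ring.choose (-x) n = (-1) ^ n * Ring.choose (x + n - 1) n := by
  rw [Ring.choose_neg, Int.negOnePow_def, Units.smul_def]
  simp

/-- Vandermonde in disguise: reflecting `binom(-i, q)` and the second factor by `choose_neg_eq`
makes both upper arguments constant along the antidiagonal, with sum `i + q - 1`. -/
lemma sum_choose_mul_choose_neg (k i : ℤ) (t q : ℕ) :
    ∑ p ∈ Finset.HasAntidiagonal.antidiagonal q, (-1) ^ p.2 *
      Ring.choose (k + (t + q : ℕ) - i - 1) p.2 * Ring.choose (k - 2 * i + (t + p.1 : ℕ) - 1) p.1 =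
    Ring.choose (-i) q := by
  rw [choose_neg_eq, show i + (q : ℤ) - 1 =
    -(k - 2 * i + t) + (k + (t + q : ℕ) - i - 1) by push_cast; ring,
    Ring.add_choose_eq _ (Commute.all _ _), Finset.mul_sum]
  refine Finset.sum_congr rfl fun p hp => ?_
  rw [choose_neg_eq, ← Finset.HasAntidiagonal.mem_antidiagonal.1 hp, pow_add,
    show k - 2 * i + (t + p.1 : ℕ) - 1 = k - 2 * i + t + (p.1 : ℤ) - 1 by push_cast; ring]
  have h1 : ((-1 : ℤ) ^ p.1) * (-1) ^ p.1 = 1 := by rw [← mul_pow]; simp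
  linear_combination (-(-1) ^ p.2 *
    Ring.choose (k + ((t + (p.1 + p.2) : ℕ) : ℤ) - i - 1) p.2 *
      Ring.choose (k - 2 * i + t + (p.1 : ℤ) - 1) p.1) * h1

lemma sum_antidiagonal_assoc {M : Type*} [AddCommMonoid M] (n : ℕ) (f : ℕ → ℕ → ℕ → M) :
    ∑ p ∈ Finset.HasAntidiagonal.antidiagonal n,
      ∑ q ∈ Finset.HasAntidiagonal.antidiagonal p.1, f q.1 q.2 p.2 =
    ∑ p ∈ Finset.HasAntidiagonal.antidiagonal n,
      ∑ q ∈ Finset.HasAntidiagonal.antidiagonal p.2, f p.1 q.1 q.2 := by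
  rw [Finset.sum_sigma', Finset.sum_sigma']
  refine Finset.sum_nbij' (fun x => ⟨(x.2.1, x.2.2 + x.1.2), (x.2.2, x.1.2)⟩)
    (fun x => ⟨(x.1.1 + x.2.1, x.2.2), (x.1.1, x.2.1)⟩) ?_ ?_ ?_ ?_ ?_ <;>
  · simp only [Finset.mem_sigma, Finset.HasAntidiagonal.mem_antidiagonal, and_imp, Sigma.forall,
      Prod.forall]
    intros
    first
    | rfl
    | (constructor <;> omega)
    | (subst_vars; exact ⟨by omega, trivial⟩)
    | (subst_vars; rfl)

variable {F : Type*} [Field F] [Finite F]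

/-! ### Rules for hyperderivatives -/

lemma HasPS.congr_translate {f : Omega F → CInf F} {z : Omega F} {c : CInf F} {g : CInf F → CInf F}
    {a : ℕ → CInf F} (hcz : ‖c‖ < imagAbs z) (h : HasPS c g a)
    (hg : ∀ w : Omega F, ‖(w : CInf F) - z‖ ≤ ‖c‖ → g (w - z) = f w) : HasPS c (translate f z) a :=
  h.congr fun ε hε => by
    obtain ⟨w, hw⟩ := exists_eq_add (hε.trans_lt hcz)
    have hwz : (w : CInf F) - z = ε := by rw [hw]; ring
    rw [translate_eq f hw, ← hwz]
    exact hg w (hwz ▸ hε)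

lemma exists_small_radius (z : Omega F) : ∃ c : CInf F, c ≠ 0 ∧ ‖c‖ < imagAbs z :=
  exists_norm_lt_CInf (imagAbs_pos z)

section Rules

variable {f f' : Omega F → CInf F}

lemma hyperDeriv_add (h : IsRigidAnalytic f) (h' : IsRigidAnalytic f') (n : ℕ) (z : Omega F) :
    hyperDeriv n (fun z => f z + f' z) z = hyperDeriv n f z + hyperDeriv n f' z := by
  obtain ⟨c, hc, hcz⟩ := exists_small_radius z
  refine (((h.hasPS z hc hcz).add (h'.hasPS z hc hcz)).congr_translate hcz
    fun w _ => ?_).hyperDeriv_eq hc n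
  rw [translate_sub, translate_sub]

lemma hyperDeriv_const_mul (h : IsRigidAnalytic f) (b : CInf F) (n : ℕ) (z : Omega F) :
    hyperDeriv n (fun z => b * f z) z = b * hyperDeriv n f z := by
  obtain ⟨c, hc, hcz⟩ := exists_small_radius z
  refine (((h.hasPS z hc hcz).const_mul b).congr_translate hcz fun w _ => ?_).hyperDeriv_eq hc n
  rw [translate_sub]

lemma hyperDeriv_mul (h : IsRigidAnalytic f) (h' : IsRigidAnalytic f') (n : ℕ) (z : Omega F) :
    hyperDeriv n (fun z => f z * f' z) z = ∑ p ∈ Finset.HasAntidiagonal.antidiagonal n,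
      hyperDeriv p.1 f z * hyperDeriv p.2 f' z := by
  obtain ⟨c, hc, hcz⟩ := exists_small_radius z
  refine (((h.hasPS z hc hcz).mul (h'.hasPS z hc hcz)).congr_translate hcz
    fun w _ => ?_).hyperDeriv_eq hc n
  rw [translate_sub, translate_sub]

lemma hyperDeriv_zero_fun (n : ℕ) (z : Omega F) :
    hyperDeriv n (fun _ : Omega F => (0 : CInf F)) z = 0 := by
  simpa using hyperDeriv_const_mul (IsRigidAnalytic.const 0) 0 n z

lemma hyperDeriv_sum {ι : Type*} (s : Finset ι) {f : ι → Omega F → CInf F}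
    (h : ∀ i ∈ s, IsRigidAnalytic (f i)) (n : ℕ) (z : Omega F) :
    hyperDeriv n (fun z => ∑ i ∈ s, f i z) z = ∑ i ∈ s, hyperDeriv n (f i) z := by
  classical
  induction s using Finset.induction_on with
  | empty => simpa using hyperDeriv_zero_fun n z
  | insert i s hi ih =>
    simp only [Finset.sum_insert hi]
    rw [hyperDeriv_add (h i (Finset.mem_insert_self _ _))
      (IsRigidAnalytic.sum s fun j hj => h j (Finset.mem_insert_of_mem hj)),
      ih fun j hj => h j (Finset.mem_insert_of_mem hj)]

end Rules

/-! ### Automorphy factors and the slash operator. -/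

lemma norm_kappa_mul_imagAbs_le (γ : GL (Fin 2) (KInf F)) (z : Omega F) :
    ‖kappa γ z‖ * imagAbs z ≤ 1 := by
  rw [kappa, norm_div, norm_algebraMap_CInf, div_mul_eq_mul_div, div_le_one (norm_denom_pos γ z)]
  exact norm_linear_ge _ _ z

lemma norm_kappa_mul_lt (γ : GL (Fin 2) (KInf F)) {z : Omega F} {c : CInf F}
    (hcz : ‖c‖ < imagAbs z) : ‖kappa γ z * c‖ < 1 := by
  rw [norm_mul]
  rcases eq_or_ne ‖kappa γ z‖ 0 with h | h
  · simp [h]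
  · exact (mul_lt_mul_of_pos_left hcz (lt_of_le_of_ne (norm_nonneg _) h.symm)).trans_le
      (norm_kappa_mul_imagAbs_le γ z)

lemma denom_eq_mul (γ : GL (Fin 2) (KInf F)) (z w : Omega F) :
    denom γ w = denom γ z * (1 + kappa γ z * (w - z)) := by
  have := denom_ne_zero γ z
  rw [kappa, mul_add, mul_one, ← mul_assoc, mul_div_cancel₀ _ this]
  simp only [denom]
  ring

/-- Since `κ(w) = κ(z) (1 + κ(z) (w - z))⁻¹`, this is the binomial series with exponent `-i`. -/
lemma hyperDeriv_kappa_pow (γ : GL (Fin 2) (KInf F)) (i n : ℕ) (z : Omega F) :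
    hyperDeriv n (fun z => kappa γ z ^ i) z =
      ((Ring.choose (-i : ℤ) n : ℤ) : CInf F) * kappa γ z ^ (i + n) := by
  obtain ⟨c, hc, hcz⟩ := exists_small_radius z
  have h := (HasPS.zpow_linear (norm_kappa_mul_lt γ hcz) (-i)).const_mul (kappa γ z ^ i)
  refine ((h.congr_translate hcz fun w _ => ?_).hyperDeriv_eq hc n).trans (by rw [pow_add]; ring)
  have h1 := denom_eq_mul γ z w
  have hw := denom_ne_zero γ w
  have hz := denom_ne_zero γ z
  have h2 : 1 + kappa γ z * ((w : CInf F) - z) ≠ 0 := fun h0 => hw (by rw [h1, h0, mul_zero])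
  have h3 : kappa γ w = kappa γ z * (1 + kappa γ z * ((w : CInf F) - z))⁻¹ := by
    rw [kappa, h1, ← div_div, div_eq_mul_inv, ← kappa]
  rw [h3, mul_pow, zpow_neg, zpow_natCast, inv_pow]

/-- The transformation of hyperderivatives under the slash operator. -/
lemma slash_hyperDeriv {f : Omega F → CInf F} (hf : IsRigidAnalytic f) (k m : ℤ) (n : ℕ)
    (γ : GL (Fin 2) (KInf F)) (z : Omega F) :
    slash (k + 2 * n) (m + n) (hyperDeriv n f) γ z =
      ∑ p ∈ Finset.HasAntidiagonal.antidiagonal n, ((Ring.choose (k + n - 1) p.2 : ℤ) : CInf F) *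
        kappa γ z ^ p.2 * hyperDeriv p.1 (slash k m f γ) z := by
  obtain ⟨c, hc, hcz⟩ := exists_small_radius z
  have hj := denom_ne_zero γ z
  have hD := detC_ne_zero γ
  -- `μ` is the derivative of `γ` at `z`. The parameter `v` below is chosen so that `γ` becomes
  -- exactly linear: the point `z + v / (1 - κ v)` goes to `γ z + μ v`.
  set μ : CInf F := detC γ / denom γ z ^ 2 with hμ
  have hμ0 : μ ≠ 0 := div_ne_zero hD (pow_ne_zero _ hj)
  have hμc : ‖μ * c‖ < imagAbs (moebius γ z) := by
    refine lt_of_lt_of_le ?_ (imagAbs_moebius_ge γ z)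
    rw [norm_mul, hμ, norm_div, norm_pow, div_mul_eq_mul_div]
    have := norm_pos_iff.2 hD
    have := norm_denom_pos γ z
    gcongr
  have hκ := norm_kappa_mul_lt γ hcz
  have h1 := ((hf.hasPS (moebius γ z) (mul_ne_zero hμ0 hc) hμc).scale (b := μ) (c' := c)
    le_rfl).const_mul (detC γ ^ m * denom γ z ^ (-k))
  -- At `w = z + v / (1 - κ v)` the denominator is `(c z + d) / (1 - κ v)`, so substitution with
  -- weight `k` cancels the dependence of the automorphy factor on `v`.
  have h2 := ((hf.slash k m γ).hasPS z hc hcz).subst hκ k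
  have h3 := congrFun (h1.unique hc (h2.congr fun v hv => ?_)) n
  · rw [← h3, slash, hμ, div_pow, zpow_add₀ hD, neg_add, zpow_add₀ hj, zpow_neg _ (2 * (n : ℤ)),
      zpow_mul, zpow_natCast, zpow_natCast, zpow_ofNat]
    field_simp
  · have hκv : ‖kappa γ z * v‖ < 1 := by
      refine lt_of_le_of_lt ?_ hκ
      rw [norm_mul, norm_mul]
      gcongr
    have hn : ‖1 - kappa γ z * v‖ = 1 := by
      rw [sub_eq_add_neg]; exact norm_one_add (by simpa using hκv)
    have hn0 : 1 - kappa γ z * v ≠ 0 := fun h => by simp [h] at hn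
    have hε : ‖v / (1 - kappa γ z * v)‖ < imagAbs z := by
      rw [norm_div, hn, div_one]; exact hv.trans_lt hcz
    obtain ⟨w, hw⟩ := exists_eq_add hε
    have hden : denom γ w = denom γ z / (1 - kappa γ z * v) := by
      rw [denom_eq_mul γ z w, hw]
      field_simp
      ring
    have hmoe : (moebius γ w : CInf F) = moebius γ z + μ * v := by
      have hjw := denom_ne_zero γ w
      have e1 : (moebius γ w : CInf F) - moebius γ z =
          detC γ * (w - z) / (denom γ z * denom γ w) := by
        rw [moebius_val, moebius_val, div_sub_div _ _ hjw hj, mul_comm (denom γ w) (denom γ z)]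
        congr 1
        rw [detC_eq]
        simp only [denom, map_sub, map_mul]
        ring
      rw [← sub_eq_iff_eq_add', e1, hden, hw, hμ, add_sub_cancel_left]
      generalize 1 - kappa γ z * v = t at hn0
      field_simp
    rw [translate_eq _ hw, translate_eq f hmoe, slash, hden, div_zpow, zpow_neg (1 - _)]
    field_simp

/-! ### Boundedness on vertical lines. -/

lemma BoundedOnVerticalLines.add {g g' : Omega F → CInf F} (h : BoundedOnVerticalLines g)
    (h' : BoundedOnVerticalLines g') : BoundedOnVerticalLines fun z => g z + g' z := by
  obtain ⟨N, B, h⟩ := h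
  obtain ⟨N', B', h'⟩ := h'
  exact ⟨max N N', B + B', fun z hz => (norm_add_le _ _).trans
    (add_le_add (h z ((le_max_left _ _).trans hz)) (h' z ((le_max_right _ _).trans hz)))⟩

lemma BoundedOnVerticalLines.mul {g g' : Omega F → CInf F} (h : BoundedOnVerticalLines g)
    (h' : BoundedOnVerticalLines g') : BoundedOnVerticalLines fun z => g z * g' z := by
  obtain ⟨N, B, h⟩ := h
  obtain ⟨N', B', h'⟩ := h'
  refine ⟨max N N', B * B', fun z hz => ?_⟩
  have h1 := h z ((le_max_left _ _).trans hz)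
  rw [norm_mul]
  exact mul_le_mul h1 (h' z ((le_max_right _ _).trans hz)) (norm_nonneg _)
    ((norm_nonneg _).trans h1)

lemma BoundedOnVerticalLines.const (b : CInf F) :
    BoundedOnVerticalLines fun _ : Omega F => b := ⟨0, ‖b‖, fun _ _ => le_rfl⟩

lemma BoundedOnVerticalLines.sum {ι : Type*} (s : Finset ι) {g : ι → Omega F → CInf F}
    (h : ∀ i ∈ s, BoundedOnVerticalLines (g i)) :
    BoundedOnVerticalLines fun z => ∑ i ∈ s, g i z := by
  classical
  induction s using Finset.induction_on with
  | empty => simpa using const (0 : CInf F)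
  | insert i s hi ih =>
    simp only [Finset.sum_insert hi]
    exact (h i (Finset.mem_insert_self _ _)).add (ih fun j hj => h j (Finset.mem_insert_of_mem hj))

lemma BoundedOnVerticalLines.pow {g : Omega F → CInf F} (h : BoundedOnVerticalLines g) (n : ℕ) :
    BoundedOnVerticalLines fun z => g z ^ n := by
  induction n with
  | zero => simpa using const (1 : CInf F)
  | succ n ih => simpa only [pow_succ] using ih.mul h

lemma boundedOnVerticalLines_kappa (γ : GL (Fin 2) (KInf F)) :
    BoundedOnVerticalLines (kappa γ) :=
  ⟨1, 1, fun z hz => (le_mul_of_one_le_right (norm_nonneg _) hz).trans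
    (norm_kappa_mul_imagAbs_le γ z)⟩

/-- For `|z|_i ≥ 2` the function `|·|_i` is constant on the closed unit disc about `z`, so the
Cauchy estimate with radius one passes the same bound on. -/
lemma BoundedOnVerticalLines.hyperDeriv {g : Omega F → CInf F} (hg : IsRigidAnalytic g)
    (h : BoundedOnVerticalLines g) (n : ℕ) : BoundedOnVerticalLines (hyperDeriv n g) := by
  obtain ⟨N, B, h⟩ := h
  refine ⟨max N 2, B, fun z hz => ?_⟩
  have h1 : ‖(1 : CInf F)‖ < imagAbs z := by
    rw [norm_one]
    exact lt_of_lt_of_le (by norm_num) ((le_max_right _ _).trans hz)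
  have h2 := (hg.hasPS z one_ne_zero h1).coeff_le (B := B) (fun ε hε => by
    obtain ⟨w, hw⟩ := exists_eq_add (hε.trans_lt h1)
    have hwz : (w : CInf F) - z = ε := by rw [hw]; ring
    rw [translate_eq g hw]
    exact h w ((le_max_left _ _).trans (hz.trans_eq
      (imagAbs_eq_of_norm_sub_lt (by rw [hwz]; exact hε.trans_lt h1)).symm))) n
  simpa using h2

lemma BoundedOnVerticalLines.slash_hyperDeriv {f : Omega F → CInf F} (hf : IsRigidAnalytic f)
    {k m : ℤ} {γ : GL (Fin 2) (KInf F)} (h : BoundedOnVerticalLines (slash k m f γ)) (n : ℕ) :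
    BoundedOnVerticalLines
      (slash (k + 2 * n) (m + n) (DrinfeldQM.hyperDeriv n f) γ) := by
  rw [funext (DrinfeldQM.slash_hyperDeriv hf k m n γ)]
  exact sum _ fun p _ => ((const _).mul ((boundedOnVerticalLines_kappa γ).pow _)).mul
    (h.hyperDeriv (hf.slash k m γ) p.1)

/-! ### Periodic functions -/

lemma periodicRigid_add {f g : Omega F → CInf F} (hf : f ∈ periodicRigid F)
    (hg : g ∈ periodicRigid F) : f + g ∈ periodicRigid F := by
  obtain ⟨hf, I, hI, hfI⟩ := hf
  obtain ⟨hg, J, hJ, hgJ⟩ := hg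
  refine ⟨hf.add hg, I * J, ?_, fun a ha z w hw => ?_⟩
  · rw [Ne, Ideal.mul_eq_bot]
    exact not_or.2 ⟨hI, hJ⟩
  · have hIJ : a ∈ I ⊓ J := Ideal.mul_le_inf ha
    exact congrArg₂ (· + ·) (hfI a hIJ.1 z w hw) (hgJ a hIJ.2 z w hw)

lemma periodicRigid_const_mul {f : Omega F → CInf F} (b : CInf F) (hf : f ∈ periodicRigid F) :
    (fun z => b * f z) ∈ periodicRigid F := by
  obtain ⟨hf, I, hI, hfI⟩ := hf
  exact ⟨(IsRigidAnalytic.const b).mul hf, I, hI, fun a ha z w hw =>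
    congrArg (b * ·) (hfI a ha z w hw)⟩

lemma periodicRigid_zero : (0 : Omega F → CInf F) ∈ periodicRigid F :=
  ⟨IsRigidAnalytic.const 0, ⊤, top_ne_bot, fun _ _ _ _ _ => rfl⟩

lemma periodicRigid_hyperDeriv {f : Omega F → CInf F} (hf : f ∈ periodicRigid F) (n : ℕ) :
    hyperDeriv n f ∈ periodicRigid F := by
  obtain ⟨hf, I, hI, hfI⟩ := hf
  refine ⟨hf.hyperDeriv n, I, hI, fun a ha z w hw => ?_⟩
  obtain ⟨c, hc, hcz⟩ := exists_norm_lt_CInf (F := F) (lt_min (imagAbs_pos z) (imagAbs_pos w))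
  have hz := hcz.trans_le (min_le_left _ _)
  have hw' := hcz.trans_le (min_le_right _ _)
  refine ((hf.hasPS z hc hz).congr fun ε hε => ?_).hyperDeriv_eq hc n
  obtain ⟨z', hz'⟩ := exists_eq_add (hε.trans_lt hz)
  obtain ⟨w', hw''⟩ := exists_eq_add (hε.trans_lt hw')
  rw [translate_eq f hz', translate_eq f hw'', hfI a ha z' w']
  rw [hw'', hz', hw]
  ring

end

section

/-- The range on the left stops at the true degree, which cancellation may lower. Additivity of `φ`
lets the sum be computed from the monomials anyway. -/
lemma sum_map_coeff_sum_monomial {ι R M : Type*} [Semiring R] [AddCommMonoid M] (φ : ℕ → R →+ M)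
    (s : Finset ι) (d : ι → ℕ) (r : ι → R) :
    ∑ j ∈ Finset.range ((∑ x ∈ s, monomial (d x) (r x)).natDegree + 1),
      φ j ((∑ x ∈ s, monomial (d x) (r x)).coeff j) = ∑ x ∈ s, φ (d x) (r x) := by
  rw [← Polynomial.sum_over_range (p := ∑ x ∈ s, monomial (d x) (r x)) (f := fun j a => φ j a)
    fun j => map_zero _]
  let Φ : R[X] →+ M :=
    { toFun := fun Q => Q.sum fun j a => φ j a
      map_zero' := Polynomial.sum_zero_index _
      map_add' := fun p q => Polynomial.sum_add_index p q _ (fun j => map_zero _)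
        fun j => map_add (φ j) }
  change Φ _ = _
  rw [map_sum]
  exact Finset.sum_congr rfl fun x _ => Polynomial.sum_monomial_index _ _ (map_zero _)

variable {F : Type*} [Field F] [Finite F]

/-! ### The associated polynomial -/

/-- For fixed `z`, the lower unipotent matrices with entry `a b`, `b ∈ I` nonzero, lie in `Γ` and
give infinitely many values of `κ`. The two polynomials, evaluated at `z`, agree at all of them. -/
lemma IsAssocPoly.unique {Γ : Subgroup (GL (Fin 2) (RatFunc F))} {I : Ideal F[X]} (hI : I ≠ ⊥)
    (hΓ : principalCongruence F I ≤ Γ) {k m : ℤ} {f : Omega F → CInf F}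
    {P Q : (Omega F → CInf F)[X]} (hP : IsAssocPoly Γ k m f P) (hQ : IsAssocPoly Γ k m f Q) :
    P = Q := by
  obtain ⟨b, hbI, hb0⟩ := Submodule.exists_mem_ne_zero_of_ne_bot hI
  let ι : F[X] →+* CInf F := (algebraMap (KInf F) (CInf F)).comp
    ((algebraMap (RatFunc F) (KInf F)).comp (algebraMap F[X] (RatFunc F)))
  have hι : Function.Injective ι := (algebraMap (KInf F) (CInf F)).injective.comp
    ((algebraMap (RatFunc F) (KInf F)).injective.comp (RatFunc.algebraMap_injective F))
  suffices h : ∀ z : Omega F, P.map (Pi.evalRingHom _ z) = Q.map (Pi.evalRingHom _ z) by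
    ext i z
    simpa using congrArg (fun R => R.coeff i) (h z)
  intro z
  have hz : ∀ a : F[X], ι a * (z : CInf F) + 1 ≠ 0 := fun a => by
    have h1 : ι a = algebraMap (KInf F) (CInf F)
      (algebraMap (RatFunc F) (KInf F) (algebraMap F[X] (RatFunc F) a)) := rfl
    rw [h1]
    simpa using linear_ne_zero (c := algebraMap (RatFunc F) (KInf F) (algebraMap F[X] (RatFunc F) a))
      (d := 1) (Or.inr one_ne_zero) z
  refine Polynomial.eq_of_infinite_eval_eq _ _ (Set.Infinite.mono ?_
    (Set.infinite_range_of_injective (f := fun a : F[X] => ι (a * b) / (ι (a * b) * z + 1)) ?_))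
  · rintro _ ⟨a, rfl⟩
    let M : Matrix (Fin 2) (Fin 2) F[X] := !![1, 0; a * b, 1]
    have hM : M.det = 1 := by simp [M, Matrix.det_fin_two]
    let γ : GL (Fin 2) F[X] := Matrix.GeneralLinearGroup.mk'' M (hM ▸ isUnit_one)
    have hγM : ∀ i j, γ i j = M i j := fun i j => rfl
    let γ' : GL (Fin 2) (RatFunc F) := Matrix.GeneralLinearGroup.map (algebraMap F[X] (RatFunc F)) γ
    have hγ : γ' ∈ Γ := by
      refine hΓ (Subgroup.mem_map_of_mem _ ?_)
      rw [MonoidHom.mem_ker]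
      ext i j
      rw [Matrix.GeneralLinearGroup.map_apply, hγM]
      have hab : Ideal.Quotient.mk I (a * b) = 0 :=
        Ideal.Quotient.eq_zero_iff_mem.2 (I.mul_mem_left a hbI)
      fin_cases i <;> fin_cases j <;> simp [M, -map_mul, hab]
    have hκ : kappa (toInf F γ') z = ι (a * b) / (ι (a * b) * z + 1) := by
      have h10 : algebraMap (KInf F) (CInf F) (toInf F γ' 1 0) = ι (a * b) := rfl
      have h11 : algebraMap (KInf F) (CInf F) (toInf F γ' 1 1) = ι 1 := rfl
      rw [kappa, denom, h10, h11, map_one]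
    have h := (hP.2 γ' hγ z).symm.trans (hQ.2 γ' hγ z)
    change eval (ι (a * b) / (ι (a * b) * z + 1)) _ = eval (ι (a * b) / (ι (a * b) * z + 1)) _
    rw [← hκ, eval_map, eval_map, eval₂_eq_sum_range, eval₂_eq_sum_range]
    exact h
  · intro a a' h
    dsimp only at h
    rw [div_eq_div_iff (hz _) (hz _)] at h
    have : ι (a * b) = ι (a' * b) := by linear_combination h
    exact mul_right_cancel₀ hb0 (hι this)

/-- The associated polynomial of `𝒟_n f` in terms of the one of `f`. -/
def derivPoly (k : ℤ) (n : ℕ) (P : (Omega F → CInf F)[X]) : (Omega F → CInf F)[X] :=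
  ∑ x ∈ Finset.range (P.natDegree + 1) ×ˢ Finset.HasAntidiagonal.antidiagonal n,
    monomial (x.1 + x.2.2) fun z =>
      ((Ring.choose (k + n - x.1 - 1) x.2.2 : ℤ) : CInf F) * hyperDeriv x.2.1 (P.coeff x.1) z

lemma natDegree_derivPoly_le (k : ℤ) (n : ℕ) (P : (Omega F → CInf F)[X]) :
    (derivPoly k n P).natDegree ≤ P.natDegree + n := by
  refine natDegree_sum_le_of_forall_le _ _ fun x hx => (natDegree_monomial_le _).trans ?_
  rw [Finset.mem_product, Finset.mem_range, Finset.HasAntidiagonal.mem_antidiagonal] at hx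
  omega

lemma sum_map_coeff_derivPoly (φ : ℕ → (Omega F → CInf F) → CInf F)
    (hφ : ∀ j a b, φ j (a + b) = φ j a + φ j b) (k : ℤ) (n : ℕ) (P : (Omega F → CInf F)[X]) :
    ∑ j ∈ Finset.range ((derivPoly k n P).natDegree + 1), φ j ((derivPoly k n P).coeff j) =
      ∑ i ∈ Finset.range (P.natDegree + 1), ∑ p ∈ Finset.HasAntidiagonal.antidiagonal n,
        φ (i + p.2) fun z =>
          ((Ring.choose (k + n - i - 1) p.2 : ℤ) : CInf F) * hyperDeriv p.1 (P.coeff i) z :=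
  (sum_map_coeff_sum_monomial (fun j => AddMonoidHom.mk' (φ j) (hφ j)) _ _ _).trans
    (Finset.sum_product _ _ _)

lemma coeff_derivPoly_induction (p : (Omega F → CInf F) → Prop) (h0 : p 0)
    (hadd : ∀ f g, p f → p g → p (f + g)) (k : ℤ) (n : ℕ) (P : (Omega F → CInf F)[X]) (j : ℕ)
    (h : ∀ i r s, i + s = j → r + s = n → p fun z =>
      ((Ring.choose (k + n - i - 1) s : ℤ) : CInf F) * hyperDeriv r (P.coeff i) z) :
    p ((derivPoly k n P).coeff j) := by
  rw [derivPoly, finsetSum_coeff]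
  refine Finset.sum_induction _ p hadd h0 fun x hx => ?_
  rw [Finset.mem_product, Finset.HasAntidiagonal.mem_antidiagonal] at hx
  rw [coeff_monomial]
  split_ifs with hj
  · exact h _ _ _ hj hx.2
  · exact h0

/-- The sum of `f_i κ^i` is rigid analytic, and its hyperderivatives are given by the Leibniz
rule. -/
lemma hyperDeriv_sum_mul_kappa_pow {P : ℕ → Omega F → CInf F} (hP : ∀ i, IsRigidAnalytic (P i))
    (d : ℕ) (γ : GL (Fin 2) (KInf F)) (r : ℕ) (z : Omega F) :
    hyperDeriv r (fun z => ∑ i ∈ Finset.range d, P i z * kappa γ z ^ i) z =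
      ∑ i ∈ Finset.range d, ∑ q ∈ Finset.HasAntidiagonal.antidiagonal r, hyperDeriv q.1 (P i) z *
        (((Ring.choose (-i : ℤ) q.2 : ℤ) : CInf F) * kappa γ z ^ (i + q.2)) := by
  rw [hyperDeriv_sum _ fun i _ => (hP i).mul ((IsRigidAnalytic.kappa γ).pow i)]
  refine Finset.sum_congr rfl fun i _ => ?_
  rw [hyperDeriv_mul (hP i) ((IsRigidAnalytic.kappa γ).pow i)]
  simp only [hyperDeriv_kappa_pow]

/-- The factor `binom(-i, s)` from differentiating `κ^i` and the factor `binom(k+n-1, u)` from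
`slash_hyperDeriv` merge by Vandermonde into `binom(k+n-i-1, s+u)`. -/
lemma IsAssocPoly.hyperDeriv {Γ : Subgroup (GL (Fin 2) (RatFunc F))} {k m : ℤ}
    {f : Omega F → CInf F} {P : (Omega F → CInf F)[X]} (hf : IsRigidAnalytic f)
    (hP : IsAssocPoly Γ k m f P) (n : ℕ) :
    IsAssocPoly Γ (k + 2 * n) (m + n) (hyperDeriv n f) (derivPoly k n P) := by
  refine ⟨fun j => coeff_derivPoly_induction (· ∈ periodicRigid F) periodicRigid_zero
    (fun _ _ => periodicRigid_add) k n P j fun i r s _ _ => periodicRigid_const_mul _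
      (periodicRigid_hyperDeriv (hP.1 i) r), fun γ hγ z => ?_⟩
  have hr : ∀ i, IsRigidAnalytic (P.coeff i) := fun i => (hP.1 i).1
  rw [slash_hyperDeriv hf, funext (hP.2 γ hγ)]
  simp only [hyperDeriv_sum_mul_kappa_pow hr]
  refine Eq.trans ?_ (sum_map_coeff_derivPoly (fun j q => q z * kappa (toInf F γ) z ^ j)
    (fun j a b => by rw [Pi.add_apply, add_mul]) k n P).symm
  simp only [Finset.mul_sum]
  refine Finset.sum_comm.trans ?_
  refine Finset.sum_congr rfl fun i _ => ?_
  refine (sum_antidiagonal_assoc n fun t s u =>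
    ((Ring.choose (k + n - 1) u : ℤ) : CInf F) * kappa (toInf F γ) z ^ u *
      (DrinfeldQM.hyperDeriv t (P.coeff i) z *
        (((Ring.choose (-i : ℤ) s : ℤ) : CInf F) * kappa (toInf F γ) z ^ (i + s)))).trans ?_
  refine Finset.sum_congr rfl fun p _ => ?_
  rw [show k + (n : ℤ) - i - 1 = -i + (k + n - 1) by ring, Ring.add_choose_eq _ (Commute.all _ _),
    Int.cast_sum, Finset.sum_mul, Finset.sum_mul]
  refine Finset.sum_congr rfl fun q hq => ?_
  rw [← Finset.HasAntidiagonal.mem_antidiagonal.1 hq]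
  push_cast
  ring

lemma slash_add (k m : ℤ) (f g : Omega F → CInf F) (γ : GL (Fin 2) (KInf F)) (z : Omega F) :
    slash k m (f + g) γ z = slash k m f γ z + slash k m g γ z := by
  simp only [slash, Pi.add_apply, mul_add]

lemma slash_const_mul (k m : ℤ) (b : CInf F) (f : Omega F → CInf F) (γ : GL (Fin 2) (KInf F))
    (z : Omega F) : slash k m (fun z => b * f z) γ z = b * slash k m f γ z := by
  simp only [slash]; ring

lemma IsQuasiModularForm.hyperDeriv {Γ : Subgroup (GL (Fin 2) (RatFunc F))} {k m : ℤ} {ℓ : ℕ}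
    {f : Omega F → CInf F} (hf : IsQuasiModularForm Γ k m ℓ f) (n : ℕ) :
    IsQuasiModularForm Γ (k + 2 * n) (m + n) (ℓ + n) (hyperDeriv n f) := by
  obtain ⟨hf, P, hP, hdeg, hbd⟩ := hf
  refine ⟨hf.hyperDeriv n, derivPoly k n P, hP.hyperDeriv hf n,
    (natDegree_derivPoly_le k n P).trans (by omega), fun j γ => ?_⟩
  refine coeff_derivPoly_induction (fun q => BoundedOnVerticalLines
    (slash (k + 2 * n - 2 * j) (m + n - j) q (toInf F γ))) ?_ (fun f g h h' => ?_) k n P j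
    fun i r s his hrs => ?_
  · convert BoundedOnVerticalLines.const (0 : CInf F) using 2
    simp [slash]
  · rw [_root_.funext (slash_add _ _ f g _)]
    exact h.add h'
  · rw [_root_.funext (slash_const_mul _ _ _ _ _)]
    refine (BoundedOnVerticalLines.const _).mul ?_
    -- With `j = i + s` and `r + s = n`, the weight `k + 2n - 2j` equals `(k - 2i) + 2r` and the
    -- type `m + n - j` equals `(m - i) + r`.
    have := (hbd i γ).slash_hyperDeriv (hP.1 i).1 r
    convert this using 2
    all_goals omega

/-- The double-slash operator commutes with hyperderivatives. -/
lemma sum_slash_derivPoly {k m : ℤ} {P : (Omega F → CInf F)[X]}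
    (hP : ∀ i, IsRigidAnalytic (P.coeff i)) (n : ℕ) (γ : GL (Fin 2) (KInf F)) (z : Omega F) :
    ∑ j ∈ Finset.range ((derivPoly k n P).natDegree + 1), (-kappa γ z) ^ j *
      slash (k + 2 * n - 2 * j) (m + n - j) ((derivPoly k n P).coeff j) γ z =
    hyperDeriv n (fun z => ∑ i ∈ Finset.range (P.natDegree + 1), (-kappa γ z) ^ i *
      slash (k - 2 * i) (m - i) (P.coeff i) γ z) z := by
  have hH : ∀ i : ℕ, IsRigidAnalytic fun z => (-1) ^ i * slash (k - 2 * i) (m - i) (P.coeff i) γ z :=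
    fun i => (IsRigidAnalytic.const _).mul ((hP i).slash _ _ γ)
  have e1 : (fun z => ∑ i ∈ Finset.range (P.natDegree + 1), (-kappa γ z) ^ i *
      slash (k - 2 * i) (m - i) (P.coeff i) γ z) = fun z => ∑ i ∈ Finset.range (P.natDegree + 1),
      ((-1) ^ i * slash (k - 2 * i) (m - i) (P.coeff i) γ z) * kappa γ z ^ i := by
    funext z
    refine Finset.sum_congr rfl fun i _ => ?_
    rw [neg_pow]; ring
  rw [e1, hyperDeriv_sum_mul_kappa_pow hH]
  refine (sum_map_coeff_derivPoly (fun j q => (-kappa γ z) ^ j *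
    slash (k + 2 * n - 2 * j) (m + n - j) q γ z) (fun j a b => by rw [slash_add, mul_add])
    k n P).trans ?_
  refine Finset.sum_congr rfl fun i _ => ?_
  -- Here `slash_hyperDeriv` is applied to `f_i` in weight `k - 2i`. The index `p.1` is written as
  -- `q.1 + q.2` so that the triple sum can be reassociated.
  have e2 : ∀ p ∈ Finset.HasAntidiagonal.antidiagonal n, (-kappa γ z) ^ (i + p.2) *
      slash (k + 2 * n - 2 * (i + p.2 : ℕ)) (m + n - (i + p.2 : ℕ)) (fun z =>
        ((Ring.choose (k + n - i - 1) p.2 : ℤ) : CInf F) * hyperDeriv p.1 (P.coeff i) z) γ z =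
      ∑ q ∈ Finset.HasAntidiagonal.antidiagonal p.1, (-kappa γ z) ^ (i + p.2) *
        (((Ring.choose (k + n - i - 1) p.2 : ℤ) : CInf F) *
          (((Ring.choose (k - 2 * i + (q.1 + q.2 : ℕ) - 1) q.2 : ℤ) : CInf F) * kappa γ z ^ q.2 *
            hyperDeriv q.1 (slash (k - 2 * i) (m - i) (P.coeff i) γ) z)) := by
    intro p hp
    have hp' := Finset.HasAntidiagonal.mem_antidiagonal.1 hp
    rw [slash_const_mul, ← Finset.mul_sum, ← Finset.mul_sum]
    congr 2
    have := slash_hyperDeriv (hP i) (k - 2 * i) (m - i) p.1 γ z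
    rw [show k + 2 * (n : ℤ) - 2 * (i + p.2 : ℕ) = k - 2 * i + 2 * p.1 by omega,
      show m + (n : ℤ) - (i + p.2 : ℕ) = m - i + p.1 by omega, this]
    refine Finset.sum_congr rfl fun q hq => ?_
    rw [Finset.HasAntidiagonal.mem_antidiagonal.1 hq]
  rw [Finset.sum_congr rfl e2]
  refine (sum_antidiagonal_assoc n fun t s u => (-kappa γ z) ^ (i + u) *
        (((Ring.choose (k + n - i - 1) u : ℤ) : CInf F) *
          (((Ring.choose (k - 2 * i + (t + s : ℕ) - 1) s : ℤ) : CInf F) * kappa γ z ^ s *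
            hyperDeriv t (slash (k - 2 * i) (m - i) (P.coeff i) γ) z))).trans ?_
  refine Finset.sum_congr rfl fun p hp => ?_
  have hp' := Finset.HasAntidiagonal.mem_antidiagonal.1 hp
  rw [← sum_choose_mul_choose_neg k i p.1 p.2, hp',
    hyperDeriv_const_mul ((hP i).slash _ _ γ), Int.cast_sum, Finset.sum_mul, Finset.mul_sum]
  refine Finset.sum_congr rfl fun q hq => ?_
  rw [← Finset.HasAntidiagonal.mem_antidiagonal.1 hq, neg_pow]
  push_cast
  ring

end

section

/-! ### Finiteness of the orbit space `Γ \ ΓηΓ` -/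

section Finiteness

open scoped Pointwise

/-- Send `r = a η b` to the class of `b⁻¹` modulo `Γ ∩ η⁻¹Γη`. Equal classes put `r` in `Γ r'`, so
the map is injective on representatives, and its target is finite. -/
lemma IsOrbitRepresentatives.finite {G : Type*} [Group G] {Γ : Subgroup G} {η : G} {R : Set G}
    (hR : IsOrbitRepresentatives Γ η R)
    (h : (ConjAct.toConjAct η⁻¹ • Γ).relIndex Γ ≠ 0) : R.Finite := by
  set H := (ConjAct.toConjAct η⁻¹ • Γ).subgroupOf Γ with hH
  have : H.FiniteIndex := ⟨h⟩
  have hmem : ∀ r : R, ∃ a ∈ Γ, ∃ b ∈ Γ, (r : G) = a * η * b := fun r =>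
    DoubleCoset.mem_doubleCoset.1 (hR.1 r.2)
  choose a ha b hb hab using hmem
  refine Set.finite_coe_iff.1 (Finite.of_injective (fun r : R => ((⟨b r, hb r⟩⁻¹ : Γ) : Γ ⧸ H)) ?_)
  intro r r' hrr
  have h1 := QuotientGroup.eq.1 hrr
  rw [hH, Subgroup.mem_subgroupOf, Subgroup.mem_pointwise_smul_iff_inv_smul_mem,
    ConjAct.smul_def] at h1
  have h2 : η * (b r * (b r')⁻¹) * η⁻¹ ∈ Γ := by simpa using h1
  have h3 : (r : G) = (a r * (η * (b r * (b r')⁻¹) * η⁻¹) * (a r')⁻¹) * r' := by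
    rw [hab r, hab r']; group
  obtain ⟨x, -, hx⟩ := hR.2 r (hR.1 r.2)
  have e1 := hx r ⟨r.2, 1, Γ.one_mem, (one_mul _).symm⟩
  have e2 := hx r' ⟨r'.2, _, Γ.mul_mem (Γ.mul_mem (ha r) h2) (Γ.inv_mem (ha r')), h3⟩
  exact Subtype.ext (e1.trans e2.symm)

lemma finite_quotient_polynomial {F : Type*} [Field F] [Finite F] {I : Ideal F[X]} (hI : I ≠ ⊥) :
    Finite (F[X] ⧸ I) := by
  obtain ⟨p, rfl⟩ := (IsPrincipalIdealRing.principal I).principal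
  have hp : p ≠ 0 := by rintro rfl; simp at hI
  have := (AdjoinRoot.powerBasis hp).finite
  exact Module.finite_of_finite F (M := AdjoinRoot p)

lemma relIndex_principalCongruence_ne_zero {F : Type*} [Field F] [Finite F] {I : Ideal F[X]}
    (hI : I ≠ ⊥) : (principalCongruence F I).relIndex (glA F) ≠ 0 := by
  have := finite_quotient_polynomial hI
  have hfin : (Matrix.GeneralLinearGroup.map (n := Fin 2) (Ideal.Quotient.mk I)).ker.index ≠ 0 := by
    rw [Subgroup.index_ker]
    exact Nat.card_pos.ne'
  rw [principalCongruence, glA, MonoidHom.range_eq_map, Subgroup.relIndex_map_map, top_sup_eq,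
    Subgroup.relIndex_top_right]
  exact ne_zero_of_dvd_ne_zero hfin (Subgroup.index_dvd_of_le le_sup_left)

/-- Let `d` be a common denominator of the entries of `η` and `η⁻¹`. If `γ = 1 + d² X`, then `η⁻¹ γ
η = 1 + (d η⁻¹) X (d η)` is integral with the same determinant. -/
lemma exists_principalCongruence_le_conj {F : Type*} [Field F] (η : GL (Fin 2) (RatFunc F)) :
    ∃ I : Ideal F[X], I ≠ ⊥ ∧ principalCongruence F I ≤ ConjAct.toConjAct η • glA F := by
  obtain ⟨⟨d, hd⟩, h⟩ := IsLocalization.exist_integer_multiples_of_finite (nonZeroDivisors F[X])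
    (Sum.elim (fun p : Fin 2 × Fin 2 => η p.1 p.2) fun p : Fin 2 × Fin 2 => η⁻¹ p.1 p.2)
  have hd0 : d ≠ 0 := nonZeroDivisors.ne_zero hd
  choose N hN using fun p => h (Sum.inl p)
  choose N' hN' using fun p => h (Sum.inr p)
  let A : Matrix (Fin 2) (Fin 2) F[X] := Matrix.of fun i j => N (i, j)
  let B : Matrix (Fin 2) (Fin 2) F[X] := Matrix.of fun i j => N' (i, j)
  let φ := algebraMap F[X] (RatFunc F)
  have hA : A.map φ = φ d • (η : Matrix (Fin 2) (Fin 2) (RatFunc F)) := by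
    ext i j
    simpa [A, Algebra.smul_def] using hN (i, j)
  have hB : B.map φ = φ d • ((η⁻¹ : GL (Fin 2) (RatFunc F)) : Matrix (Fin 2) (Fin 2) (RatFunc F)) := by
    ext i j
    simpa [B, Algebra.smul_def] using hN' (i, j)
  refine ⟨Ideal.span {d ^ 2}, by simpa [Ideal.span_singleton_eq_bot] using hd0, ?_⟩
  rintro _ ⟨γ, hγ, rfl⟩
  have hX : ∀ i j, ∃ x, (γ : Matrix (Fin 2) (Fin 2) F[X]) i j =
      (1 : Matrix (Fin 2) (Fin 2) F[X]) i j + d ^ 2 * x := fun i j => by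
    have h1 : Matrix.GeneralLinearGroup.map (Ideal.Quotient.mk (Ideal.span {d ^ 2})) γ = 1 := hγ
    have h2 := congrArg (fun g : GL (Fin 2) (F[X] ⧸ Ideal.span {d ^ 2}) => g i j) h1
    have h3 : Ideal.Quotient.mk (Ideal.span {d ^ 2}) (γ i j) =
        Ideal.Quotient.mk (Ideal.span {d ^ 2}) ((1 : Matrix (Fin 2) (Fin 2) F[X]) i j) := by
      refine h2.trans ?_
      rw [Matrix.GeneralLinearGroup.coe_one, Matrix.one_apply, Matrix.one_apply]
      split_ifs <;> simp
    obtain ⟨x, hx⟩ := Ideal.mem_span_singleton.1 (Ideal.Quotient.eq.1 h3)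
    exact ⟨x, by rw [← hx]; ring⟩
  choose X hX using hX
  have hγX : (γ : Matrix (Fin 2) (Fin 2) F[X]) = 1 + d ^ 2 • Matrix.of X := by
    ext i j
    rw [hX]; simp
  let Y : Matrix (Fin 2) (Fin 2) F[X] := 1 + B * Matrix.of X * A
  have hmapγ : (γ : Matrix (Fin 2) (Fin 2) F[X]).map φ = 1 + φ d ^ 2 • (Matrix.of X).map φ := by
    rw [hγX]
    ext i j
    by_cases hij : i = j <;> simp [hij]
  have hηη : ((η⁻¹ : GL (Fin 2) (RatFunc F)) : Matrix (Fin 2) (Fin 2) (RatFunc F)) * η = 1 := by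
    rw [← Matrix.GeneralLinearGroup.coe_mul, inv_mul_cancel, Matrix.GeneralLinearGroup.coe_one]
  have hY : Y.map φ = ((η⁻¹ : GL (Fin 2) (RatFunc F)) : Matrix (Fin 2) (Fin 2) (RatFunc F)) *
      (γ : Matrix (Fin 2) (Fin 2) F[X]).map φ * η := by
    have h1 : Y.map φ = 1 + B.map φ * (Matrix.of X).map φ * A.map φ := by
      change φ.mapMatrix Y = 1 + φ.mapMatrix B * φ.mapMatrix (Matrix.of X) * φ.mapMatrix A
      simp only [Y, map_add, map_mul, map_one]
    rw [h1, hA, hB, hmapγ, mul_add, add_mul, mul_one, hηη]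
    simp only [Matrix.smul_mul, Matrix.mul_smul, smul_smul, pow_two]
  have hdet : Y.det = (γ : Matrix (Fin 2) (Fin 2) F[X]).det := by
    apply RatFunc.algebraMap_injective F
    have h1 := congrArg Matrix.det hY
    rw [Matrix.det_mul, Matrix.det_mul, mul_right_comm, ← Matrix.det_mul, hηη, Matrix.det_one,
      one_mul] at h1
    change (φ.mapMatrix Y).det = (φ.mapMatrix (γ : Matrix (Fin 2) (Fin 2) F[X])).det at h1
    rwa [← RingHom.map_det, ← RingHom.map_det] at h1
  have hunit : IsUnit Y.det := hdet ▸ (Matrix.isUnit_iff_isUnit_det _).1 γ.isUnit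
  refine Subgroup.mem_pointwise_smul_iff_inv_smul_mem.2 ⟨Matrix.GeneralLinearGroup.mk'' Y hunit, ?_⟩
  rw [← ConjAct.toConjAct_inv, ConjAct.toConjAct_smul, inv_inv]
  refine Units.ext ?_
  exact hY

lemma commensurator_glA (F : Type*) [Field F] [Finite F] (η : GL (Fin 2) (RatFunc F)) :
    η ∈ Subgroup.Commensurable.commensurator (glA F) := by
  have key : ∀ η : GL (Fin 2) (RatFunc F),
      (ConjAct.toConjAct η • glA F).relIndex (glA F) ≠ 0 := fun η => by
    obtain ⟨I, hI, hle⟩ := exists_principalCongruence_le_conj η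
    exact ne_zero_of_dvd_ne_zero (relIndex_principalCongruence_ne_zero hI)
      (Subgroup.relIndex_dvd_of_le_left _ hle)
  rw [Subgroup.Commensurable.commensurator_mem_iff]
  refine ⟨key η, ?_⟩
  have := key η⁻¹
  rwa [← Subgroup.relIndex_pointwise_smul (ConjAct.toConjAct η), ConjAct.toConjAct_inv,
    smul_inv_smul] at this

lemma IsOrbitRepresentatives.finite_of_commensurable {F : Type*} [Field F] [Finite F]
    {Γ : Subgroup (GL (Fin 2) (RatFunc F))} (hΓ : Subgroup.Commensurable Γ (glA F))
    {η : GL (Fin 2) (RatFunc F)} {R : Set (GL (Fin 2) (RatFunc F))}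
    (hR : IsOrbitRepresentatives Γ η R) : R.Finite := by
  have h := commensurator_glA F η⁻¹
  rw [← hΓ.eq, Subgroup.Commensurable.commensurator_mem_iff] at h
  exact hR.finite h.1

end Finiteness

/-! ### Hecke operators -/

variable {F : Type*} [Field F] [Finite F] {Γ : Subgroup (GL (Fin 2) (RatFunc F))} {k m : ℤ}
  {f : Omega F → CInf F}

lemma IsAssocPoly.assocPoly_eq {I : Ideal F[X]} (hI : I ≠ ⊥) (hΓ : principalCongruence F I ≤ Γ)
    {P : (Omega F → CInf F)[X]} (hP : IsAssocPoly Γ k m f P) : assocPoly Γ k m f = P := by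
  have hex : ∃ P, IsAssocPoly Γ k m f P := ⟨P, hP⟩
  rw [assocPoly, dif_pos hex]
  exact hex.choose_spec.unique hI hΓ hP

lemma isRigidAnalytic_doubleSlash (hP : ∀ i, IsRigidAnalytic ((assocPoly Γ k m f).coeff i))
    (γ : GL (Fin 2) (KInf F)) : IsRigidAnalytic (doubleSlash Γ k m f γ) := by
  refine IsRigidAnalytic.sum _ fun i _ => IsRigidAnalytic.mul ?_ ((hP i).slash _ _ γ)
  simpa using ((IsRigidAnalytic.const (-1)).mul (IsRigidAnalytic.kappa γ)).pow i

/-- Finiteness of `R` excludes the default value zero of `∑ᶠ`. -/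
lemma heckeOp_apply {R : Set (GL (Fin 2) (RatFunc F))} (hR : R.Finite)
    (η : GL (Fin 2) (RatFunc F)) (k m : ℤ) (f : Omega F → CInf F) (z : Omega F) :
    heckeOp Γ η R k m f z = detC (toInf F η) ^ (k - m) *
      ∑ γ ∈ hR.toFinset, doubleSlash Γ k m f (toInf F γ) z := by
  rw [heckeOp, finsum_mem_eq_finite_toFinset_sum _ hR, Pi.smul_apply, smul_eq_mul,
    Finset.sum_apply]

end

end DrinfeldQM

end

open DrinfeldQM

theorem proposition5p6 {F : Type*} [Field F] [Finite F]
    (Γ : Subgroup (GL (Fin 2) (RatFunc F))) (hΓ : IsArithmeticCongruence Γ)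
    (k ℓ : ℕ) (m : ℤ) (f : Omega F → CInf F) (hf : IsQuasiModularForm Γ k m ℓ f)
    (η : GL (Fin 2) (RatFunc F)) (R : Set (GL (Fin 2) (RatFunc F)))
    (hR : IsOrbitRepresentatives Γ η R) (n : ℕ) :
    IsRigidAnalytic (heckeOp Γ η R k m f) ∧
    IsQuasiModularForm Γ (k + 2 * n) (m + n) (ℓ + n) (hyperDeriv n f) ∧
    heckeOp Γ η R (k + 2 * n) (m + n) (hyperDeriv n f) =
      detC (toInf F η) ^ n • hyperDeriv n (heckeOp Γ η R k m f) ∧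
    ∀ lam : CInf F, IsEigenform Γ η R k m lam f → hyperDeriv n f ≠ 0 →
      IsEigenform Γ η R (k + 2 * n) (m + n) (detC (toInf F η) ^ n * lam) (hyperDeriv n f) := by
  have hfin := hR.finite_of_commensurable hΓ.1
  obtain ⟨I, hI, hIΓ⟩ := hΓ.2
  obtain ⟨hfr, P, hP, -, -⟩ := id hf
  have hPr : ∀ i, IsRigidAnalytic (P.coeff i) := fun i => (hP.1 i).1
  have hPf := hP.assocPoly_eq hI hIΓ
  -- Uniqueness identifies the chosen associated polynomial of `𝒟_n f` with `derivPoly`, so its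
  -- double slash is explicit.
  have hQf := (hP.hyperDeriv hfr n).assocPoly_eq hI hIΓ
  have hds : ∀ γ, IsRigidAnalytic (doubleSlash Γ k m f γ) :=
    fun γ => isRigidAnalytic_doubleSlash (hPf.symm ▸ hPr) γ
  have hsum := IsRigidAnalytic.sum hfin.toFinset fun γ _ => hds (toInf F γ)
  have hT := funext (heckeOp_apply (Γ := Γ) hfin η k m f)
  have hTr : IsRigidAnalytic (heckeOp Γ η R k m f) := hT ▸ (IsRigidAnalytic.const _).mul hsum
  have hcomm : heckeOp Γ η R (k + 2 * n) (m + n) (hyperDeriv n f) =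
      detC (toInf F η) ^ n • hyperDeriv n (heckeOp Γ η R k m f) := by
    funext z
    rw [heckeOp_apply hfin, Pi.smul_apply, smul_eq_mul, hT, hyperDeriv_const_mul hsum,
      hyperDeriv_sum _ fun γ _ => hds _, ← mul_assoc]
    congr 1
    -- The normalizing exponents satisfy `(k + 2n) - (m + n) = n + (k - m)`.
    · rw [← zpow_natCast, ← zpow_add₀ (detC_ne_zero _)]
      congr 1
      ring
    · refine Finset.sum_congr rfl fun γ _ => ?_
      unfold doubleSlash
      rw [hPf, hQf]
      exact sum_slash_derivPoly hPr n (toInf F γ) z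
  refine ⟨hTr, hf.hyperDeriv n, hcomm, fun lam hlam hne => ⟨⟨_, hf.hyperDeriv n⟩, hne, ?_⟩⟩
  rw [hcomm, hlam.2.2, mul_smul]
  congr 1
  funext z
  exact hyperDeriv_const_mul hfr lam n z
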